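/- Let $H$ be a complex Hilbert space, $A\subseteq B(H)$ a unital $C^*$-algebra (with $1_A=1_H$), $G$ a discrete group and $\alpha:G\to\mathrm{Aut}(A)$ a homomorphism into the group of $*$-automorphisms of $A$. On $\ell^2(G,H)$ put $(\pi(a)\xi)(s)=\alpha_{s^{-1}}(a)\xi(s)$ and $(\lambda_r\xi)(s)=\xi(r^{-1}s)$, for $f\in\ell^1(G,A)$ put $\pi\rtimes\lambda(f)=\sum_{s\in G}\pi(f(s))\lambda_s$, and let the reduced crossed product $A\rtimes_{\alpha,r}G$ be the norm closure of $\pi\rtimes\lambda(\ell^1(G,A))$ in $B(\ell^2(G,H))$. Below, $\ell^2=\ell^2(\mathbb N)$, $\otimes$ between $C^*$-algebras is the minimal tensor product, $CB(C)$ is the space of completely bounded linear maps on a $C^*$-algebra $C$, and for $T\in CB(C)$, or for $T$ a bounded linear map of finite rank on $C$, $T\otimes\mathrm{id}$ is the bounded map on $C\otimes B(\ell^2)$ with $(T\otimes\mathrm{id})(c\otimes b)=T(c)\otimes b$. A function $F:G\to CB(A)$ which is bounded in the cb-norm is a Herz–Schur $(A,G,\alpha)$-multiplier if the map $\pi\rtimes\lambda(f)\mapsto\pi\rtimes\lambda(F\cdot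 f)$, where $(F\cdot f)(r)=F(r)(f(r))$ for $f\in\ell^1(G,A)$, extends to a completely bounded map $S_F$ on $A\rtimes_{\alpha,r}G$. Let $Q(A,G,\alpha)$ be the set of all functionals $\omega_{x,\psi}$ on $CB(A\rtimes_{\alpha,r}G)$, $\omega_{x,\psi}(T)=\psi\big((T\otimes\mathrm{id})x\big)$, with $x\in(A\rtimes_{\alpha,r}G)\otimes B(\ell^2)$ and $\psi\in\big((A\rtimes_{\alpha,r}G)\otimes B(\ell^2)\big)^*$. The system $(A,G,\alpha)$ has the approximation property (AP) if there is a net $(F_i)_i$ of Herz–Schur $(A,G,\alpha)$-multipliers such that each $F_i$ is finitely supported, each $F_i(r)$ ($r\in G$) is a finite rank map on $A$, and $\omega(S_{F_i})\to\omega(\mathrm{id})$ for all $\omega\in Q(A,G,\alpha)$. A $C^*$-algebra $C$ has the strong operator approximation property (SOAP) if there is a net $(\Phi_i)_i$ of finite rank bounded linear maps on $C$ such that $\|(\Phi_i\otimes\mathrm{id})(x)-x\|\to0$ for every $x\in C\otimes B(\ell^2)$. **Theorem.** The system $(A,G,\alpha)$ has the AP if and only if $A\rtimes_{\alpha,r}G$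 has the SOAP. -/

import Mathlib

open scoped TensorProduct

open Filter Topology

universe u v

noncomputable section

namespace CrossedProductAP

/-! ### Matrix norms and completely bounded maps -/

section CompletelyBounded

variable {K : Type*} [NormedAddCommGroup K] [InnerProductSpace ℂ K]

/-- The bounded operator on the Hilbert space `K ⊕ ⋯ ⊕ K` (`n` copies) given by an `n × n` matrix
of bounded operators on `K`. Its operator norm is the norm of the matrix in `Mₙ(B(K)) = B(Kⁿ)`. -/
def blockOperator {n : ℕ} (x : Matrix (Fin n) (Fin n) (K →L[ℂ] K)) :
    PiLp 2 (fun _ : Fin n => K) →L[ℂ] PiLp 2 (fun _ : Fin n => K) :=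
  (PiLp.continuousLinearEquiv 2 ℂ (fun _ : Fin n => K)).symm.toContinuousLinearMap ∘L
    ContinuousLinearMap.pi (fun i => ∑ j, x i j ∘L PiLp.proj 2 (fun _ : Fin n => K) j)

lemma blockOperator_apply {n : ℕ} (x : Matrix (Fin n) (Fin n) (K →L[ℂ] K))
    (ξ : PiLp 2 (fun _ : Fin n => K)) (i : Fin n) :
    blockOperator x ξ i = ∑ j, x i j (ξ j) := by
  simp [blockOperator]

lemma blockOperator_add {n : ℕ} (x y : Matrix (Fin n) (Fin n) (K →L[ℂ] K)) :
    blockOperator (x + y) = blockOperator x + blockOperator y := by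
  ext ξ i
  simp [blockOperator_apply, Finset.sum_add_distrib]

lemma blockOperator_smul {n : ℕ} (a : ℂ) (x : Matrix (Fin n) (Fin n) (K →L[ℂ] K)) :
    blockOperator (a • x) = a • blockOperator x := by
  ext ξ i
  simp [blockOperator_apply, Finset.smul_sum]

variable [CompleteSpace K] {C : StarSubalgebra ℂ (K →L[ℂ] K)}

/-- `‖T‖_cb ≤ M` for a map `T` on a concrete C*-algebra `C ⊆ B(K)`: every amplification
`[c_{ij}] ↦ [T c_{ij}]` on `Mₙ(C)` is bounded by `M`. -/
def CBBound (T : C →L[ℂ] C) (M : ℝ) : Prop :=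
  ∀ (n : ℕ) (x : Matrix (Fin n) (Fin n) C),
    ‖blockOperator (x.map fun c => (T c : K →L[ℂ] K))‖ ≤
      M * ‖blockOperator (x.map fun c => (c : K →L[ℂ] K))‖

lemma CBBound.mono {T : C →L[ℂ] C} {M N : ℝ} (h : CBBound T M) (hMN : M ≤ N) : CBBound T N :=
  fun n x => (h n x).trans (by gcongr)

variable (C) in
/-- The space `CB(C)` of completely bounded linear maps on a concrete C*-algebra `C ⊆ B(K)`. -/
def CBMap : Submodule ℂ (C →L[ℂ] C) where
  carrier := {T | ∃ M : ℝ, CBBound T M}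
  add_mem' := by
    rintro S T ⟨M, hM⟩ ⟨N, hN⟩
    refine ⟨M + N, fun n x => ?_⟩
    have h : (x.map fun c => ((S + T) c : K →L[ℂ] K)) =
        (x.map fun c => (S c : K →L[ℂ] K)) + (x.map fun c => (T c : K →L[ℂ] K)) := by
      ext; simp
    rw [h, blockOperator_add, add_mul]
    exact (norm_add_le _ _).trans (add_le_add (hM n x) (hN n x))
  zero_mem' := by
    refine ⟨0, fun n x => ?_⟩
    have h : blockOperator (x.map fun c => ((0 : C →L[ℂ] C) c : K →L[ℂ] K)) = 0 := by
      ext ξ i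
      simp [blockOperator_apply]
    rw [h, norm_zero, zero_mul]
  smul_mem' := by
    rintro a T ⟨M, hM⟩
    refine ⟨‖a‖ * M, fun n x => ?_⟩
    have h : (x.map fun c => ((a • T) c : K →L[ℂ] K)) =
        a • (x.map fun c => (T c : K →L[ℂ] K)) := by
      ext; simp
    rw [h, blockOperator_smul, norm_smul, mul_assoc]
    gcongr
    exact hM n x

variable (C) in
/-- The identity map of `C`, as a completely bounded map. -/
def CBMap.id : CBMap C := ⟨ContinuousLinearMap.id ℂ C, 1, fun n x => by simp⟩

end CompletelyBounded

/-! ### The minimal tensor product with `B(ℓ²)` and the maps `T ⊗ id` -/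

section Tensor

/-- The Hilbert space `ℓ² = ℓ²(ℕ)`. -/
abbrev ell2 : Type := lp (fun _ : ℕ => ℂ) 2

variable (K : Type*) [NormedAddCommGroup K] [InnerProductSpace ℂ K]

/-- The Hilbert space tensor product `K ⊗ ℓ²`. -/
def HilbertTensor : Type _ := UniformSpace.Completion (K ⊗[ℂ] ell2)

instance : NormedAddCommGroup (HilbertTensor K) :=
  inferInstanceAs (NormedAddCommGroup (UniformSpace.Completion (K ⊗[ℂ] ell2)))

instance : InnerProductSpace ℂ (HilbertTensor K) :=
  inferInstanceAs (InnerProductSpace ℂ (UniformSpace.Completion (K ⊗[ℂ] ell2)))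

instance : CompleteSpace (HilbertTensor K) :=
  inferInstanceAs (CompleteSpace (UniformSpace.Completion (K ⊗[ℂ] ell2)))

/-- The inclusion of the algebraic tensor product `K ⊙ ℓ²` in `K ⊗ ℓ²`. -/
def HilbertTensor.incl : K ⊗[ℂ] ell2 →ₗᵢ[ℂ] HilbertTensor K :=
  UniformSpace.Completion.toComplₗᵢ

lemma HilbertTensor.denseRange_incl : DenseRange (HilbertTensor.incl K) :=
  UniformSpace.Completion.denseRange_coe

variable {K}

/-- The operator `c ⊗ b` on `K ⊗ ℓ²`. -/
def opTensor (c : K →L[ℂ] K) (b : ell2 →L[ℂ] ell2) : HilbertTensor K →L[ℂ] HilbertTensor K :=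
  (TensorProduct.mapL c b).completion

lemma opTensor_incl (c : K →L[ℂ] K) (b : ell2 →L[ℂ] ell2) (v : K ⊗[ℂ] ell2) :
    opTensor c b (HilbertTensor.incl K v) =
      HilbertTensor.incl K (TensorProduct.mapL c b v : K ⊗[ℂ] ell2) :=
  ContinuousLinearMap.completion_apply_coe (TensorProduct.mapL c b) v

lemma hilbertTensor_ext {S T : HilbertTensor K →L[ℂ] HilbertTensor K}
    (h : ∀ v : K ⊗[ℂ] ell2, S (HilbertTensor.incl K v) = T (HilbertTensor.incl K v)) : S = T :=
  ContinuousLinearMap.coeFn_injective <|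
    (HilbertTensor.denseRange_incl K).equalizer S.continuous T.continuous (funext h)

/-- `(c, b) ↦ c ⊗ b` as a bilinear map. -/
def opTensorBilin : (K →L[ℂ] K) →ₗ[ℂ] (ell2 →L[ℂ] ell2) →ₗ[ℂ]
    (HilbertTensor K →L[ℂ] HilbertTensor K) :=
  LinearMap.mk₂ ℂ opTensor
    (fun c c' b => hilbertTensor_ext fun v => by
      simp [opTensor_incl, TensorProduct.mapL_add_left])
    (fun a c b => hilbertTensor_ext fun v => by
      simp [opTensor_incl, TensorProduct.mapL_smul_left])
    (fun c b b' => hilbertTensor_ext fun v => by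
      simp [opTensor_incl, TensorProduct.mapL_add_right])
    (fun a c b => hilbertTensor_ext fun v => by
      simp [opTensor_incl, TensorProduct.mapL_smul_right])

variable [CompleteSpace K] (C : StarSubalgebra ℂ (K →L[ℂ] K))

/-- The canonical map of the algebraic tensor product `C ⊙ B(ℓ²)` into `B(K ⊗ ℓ²)`. -/
def algTensorMap : C ⊗[ℂ] (ell2 →L[ℂ] ell2) →ₗ[ℂ] (HilbertTensor K →L[ℂ] HilbertTensor K) :=
  TensorProduct.lift (opTensorBilin ∘ₗ C.toSubalgebra.val.toLinearMap)

variable {C} in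
lemma algTensorMap_tmul (c : C) (b : ell2 →L[ℂ] ell2) :
    algTensorMap C (c ⊗ₜ b) = opTensor (c : K →L[ℂ] K) b := rfl

/-- The minimal C*-tensor product `C ⊗ B(ℓ²)` of a concrete C*-algebra `C ⊆ B(K)`: the norm
closure of the algebraic tensor product in `B(K ⊗ ℓ²)`, as a normed space. -/
def minTensor : Submodule ℂ (HilbertTensor K →L[ℂ] HilbertTensor K) :=
  (LinearMap.range (algTensorMap C)).topologicalClosure

instance : CompleteSpace (minTensor C) :=
  (Submodule.isClosed_topologicalClosure _).completeSpace_coe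

/-- The canonical map of the algebraic tensor product `C ⊙ B(ℓ²)` into `C ⊗ B(ℓ²)`. -/
def toMinTensor : C ⊗[ℂ] (ell2 →L[ℂ] ell2) →ₗ[ℂ] minTensor C :=
  (algTensorMap C).codRestrict _ fun u => Submodule.le_topologicalClosure _ ⟨u, rfl⟩

lemma denseRange_toMinTensor : DenseRange (toMinTensor C) := by
  intro y
  rw [Metric.mem_closure_iff]
  intro ε hε
  have hy : (y : HilbertTensor K →L[ℂ] HilbertTensor K) ∈
      closure (LinearMap.range (algTensorMap C) : Set _) := y.2
  obtain ⟨_, ⟨u, rfl⟩, hu⟩ := Metric.mem_closure_iff.1 hy ε hε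
  exact ⟨_, ⟨u, rfl⟩, hu⟩

variable {C}

/-- The bounded map `T ⊗ id` on `C ⊗ B(ℓ²)`: the continuous extension of the map determined by
`c ⊗ b ↦ T c ⊗ b` on the algebraic tensor product. The extension exists for every completely
bounded `T` (see `amplify_toMinTensor`), in particular for every bounded `T` of finite rank. -/
def amplify (T : C →L[ℂ] C) : minTensor C →L[ℂ] minTensor C :=
  (toMinTensor C ∘ₗ TensorProduct.map T.toLinearMap LinearMap.id).extendOfNorm (toMinTensor C)


/-- The standard basis of `ℓ²`. -/
def basisVec (i : ℕ) : ell2 := lp.single 2 i (1 : ℂ)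

lemma inner_basisVec (i : ℕ) (v : ell2) : inner ℂ (basisVec i) v = v i := by
  simp [basisVec, lp.inner_single_left]

/-- The inclusion `(ξ₀, …, ξₙ₋₁) ↦ ∑ ξⱼ ⊗ eⱼ` of `Kⁿ` in `K ⊗ ℓ²`. -/
def colIncl (n : ℕ) (ξ : PiLp 2 (fun _ : Fin n => K)) : HilbertTensor K :=
  HilbertTensor.incl K (∑ j : Fin n, ξ j ⊗ₜ[ℂ] basisVec j)

lemma inner_colIncl (n : ℕ) (ξ η : PiLp 2 (fun _ : Fin n => K)) :
    inner ℂ (colIncl n η) (colIncl n ξ) = inner ℂ η ξ := by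
  rw [colIncl, colIncl, LinearIsometry.inner_map_map, PiLp.inner_apply, sum_inner]
  refine Finset.sum_congr rfl fun i _ => ?_
  rw [inner_sum, Finset.sum_eq_single i]
  · simp [TensorProduct.inner_tmul, basisVec]
  · intro j _ hj
    have hij : (i : ℕ) ≠ j := fun h => hj (Fin.ext h.symm)
    rw [TensorProduct.inner_tmul, inner_basisVec]
    simp [basisVec, hij]
  · simp

lemma norm_colIncl (n : ℕ) (ξ : PiLp 2 (fun _ : Fin n => K)) : ‖colIncl n ξ‖ = ‖ξ‖ := by
  have h := inner_colIncl n ξ ξ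
  rw [inner_self_eq_norm_sq_to_K, inner_self_eq_norm_sq_to_K] at h
  have h' : ‖colIncl n ξ‖ ^ 2 = ‖ξ‖ ^ 2 := by exact_mod_cast h
  exact (sq_eq_sq₀ (norm_nonneg _) (norm_nonneg _)).1 h'

/-- The slice map `c ⊗ b ↦ ⟨eᵢ, b eⱼ⟩ c` on the algebraic tensor product. -/
def slice (C : StarSubalgebra ℂ (K →L[ℂ] K)) (i j : ℕ) : C ⊗[ℂ] (ell2 →L[ℂ] ell2) →ₗ[ℂ] C :=
  TensorProduct.lift <| LinearMap.mk₂ ℂ (fun c b => (b (basisVec j) i) • c)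
    (fun c c' b => by simp) (fun a c b => by simp [smul_comm a])
    (fun c b b' => by simp [add_smul]) (fun a c b => by simp [mul_smul])

lemma slice_tmul (i j : ℕ) (c : C) (b : ell2 →L[ℂ] ell2) :
    slice C i j (c ⊗ₜ b) = (b (basisVec j) i) • c := rfl

lemma slice_map (T : C →L[ℂ] C) (i j : ℕ) (u : C ⊗[ℂ] (ell2 →L[ℂ] ell2)) :
    slice C i j (TensorProduct.map T.toLinearMap LinearMap.id u) = T (slice C i j u) := by
  induction u with
  | zero => simp
  | add u v hu hv => simp only [map_add, hu, hv]
  | tmul c b => simp [slice_tmul]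

/-- The `n × n` corner of the matrix of an element of the algebraic tensor product. -/
def corner (n : ℕ) (u : C ⊗[ℂ] (ell2 →L[ℂ] ell2)) : Matrix (Fin n) (Fin n) C :=
  Matrix.of fun i j => slice C i j u

lemma inner_corner (n : ℕ) (u : C ⊗[ℂ] (ell2 →L[ℂ] ell2)) (ξ η : PiLp 2 (fun _ : Fin n => K)) :
    inner ℂ (colIncl n η) (algTensorMap C u (colIncl n ξ)) =
      inner ℂ η (blockOperator ((corner n u).map fun c => (c : K →L[ℂ] K)) ξ) := by
  simp only [PiLp.inner_apply, blockOperator_apply, corner, Matrix.map_apply, Matrix.of_apply]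
  induction u with
  | zero => simp
  | add u v hu hv =>
    simp only [map_add, add_apply, inner_add_right, hu, hv, AddMemClass.coe_add,
      Finset.sum_add_distrib]
  | tmul c b =>
    rw [algTensorMap_tmul, colIncl, colIncl, opTensor_incl, LinearIsometry.inner_map_map, sum_inner]
    refine Finset.sum_congr rfl fun i _ => ?_
    simp [slice_tmul, TensorProduct.inner_tmul, inner_basisVec, inner_sum, inner_smul_right,
      mul_comm]

lemma norm_corner_le (n : ℕ) (u : C ⊗[ℂ] (ell2 →L[ℂ] ell2)) :
    ‖blockOperator ((corner n u).map fun c => (c : K →L[ℂ] K))‖ ≤ ‖algTensorMap C u‖ := by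
  refine ContinuousLinearMap.opNorm_le_bound _ (norm_nonneg _) fun ξ => ?_
  set η := blockOperator ((corner n u).map fun c => (c : K →L[ℂ] K)) ξ with hη
  have h : ‖η‖ ^ 2 ≤ ‖η‖ * (‖algTensorMap C u‖ * ‖ξ‖) := by
    have h1 : ((‖η‖ ^ 2 : ℝ) : ℂ) = inner ℂ (colIncl n η) (algTensorMap C u (colIncl n ξ)) := by
      rw [inner_corner, ← hη, inner_self_eq_norm_sq_to_K]
      norm_cast
    calc ‖η‖ ^ 2 = ‖((‖η‖ ^ 2 : ℝ) : ℂ)‖ := by simp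
      _ ≤ ‖colIncl n η‖ * ‖algTensorMap C u (colIncl n ξ)‖ := by
        rw [h1]; exact norm_inner_le_norm _ _
      _ ≤ ‖η‖ * (‖algTensorMap C u‖ * ‖ξ‖) := by
        rw [norm_colIncl]
        gcongr
        exact (ContinuousLinearMap.le_opNorm _ _).trans_eq (by rw [norm_colIncl])
  rcases (norm_nonneg η).eq_or_lt with h0 | h0
  · rw [← h0]; positivity
  · rw [sq] at h
    exact le_of_mul_le_mul_left h h0

lemma colIncl_add (n : ℕ) (ξ η : PiLp 2 (fun _ : Fin n => K)) :
    colIncl n (ξ + η) = colIncl n ξ + colIncl n η := by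
  simp [colIncl, TensorProduct.add_tmul, Finset.sum_add_distrib]

lemma colIncl_smul (n : ℕ) (a : ℂ) (ξ : PiLp 2 (fun _ : Fin n => K)) :
    colIncl n (a • ξ) = a • colIncl n ξ := by
  simp only [colIncl, PiLp.smul_apply, ← TensorProduct.smul_tmul', ← Finset.smul_sum, map_smul]

variable (K) in
/-- The union of the subspaces `Kⁿ` of `K ⊗ ℓ²`. -/
def finiteColumns : Submodule ℂ (HilbertTensor K) where
  carrier := {v | ∃ N, ∀ n, N ≤ n → ∃ ξ, colIncl n ξ = v}
  add_mem' := by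
    rintro v w ⟨N₁, h₁⟩ ⟨N₂, h₂⟩
    refine ⟨max N₁ N₂, fun n hn => ?_⟩
    obtain ⟨ξ, rfl⟩ := h₁ n (le_of_max_le_left hn)
    obtain ⟨η, rfl⟩ := h₂ n (le_of_max_le_right hn)
    exact ⟨ξ + η, colIncl_add n ξ η⟩
  zero_mem' := ⟨0, fun n _ => ⟨0, by simp [colIncl]⟩⟩
  smul_mem' := by
    rintro a v ⟨N, h⟩
    refine ⟨N, fun n hn => ?_⟩
    obtain ⟨ξ, rfl⟩ := h n hn
    exact ⟨a • ξ, colIncl_smul n a ξ⟩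

lemma dense_finiteColumns : Dense (finiteColumns K : Set (HilbertTensor K)) := by
  have h1 : ∀ (k : K) (i : ℕ), HilbertTensor.incl K (k ⊗ₜ basisVec i) ∈ finiteColumns K := by
    refine fun k i => ⟨i + 1, fun n hn => ⟨PiLp.single 2 ⟨i, hn⟩ k, ?_⟩⟩
    rw [colIncl, Finset.sum_eq_single ⟨i, hn⟩]
    · simp
    · intro j _ hj
      simp [hj]
    · simp
  have h2 : ∀ (k : K) (v : ell2),
      HilbertTensor.incl K (k ⊗ₜ v) ∈ (finiteColumns K).topologicalClosure := by
    intro k v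
    have hs : HasSum (fun i => lp.single 2 i (v i)) v := lp.hasSum_single (by simp) v
    have hs' := ((HilbertTensor.incl K).toContinuousLinearMap ∘L
      TensorProduct.mkL ℂ K ell2 k).hasSum hs
    refine (Submodule.isClosed_topologicalClosure _).mem_of_tendsto hs'
      (Filter.Eventually.of_forall fun s => Submodule.sum_mem _ fun i _ => ?_)
    have hi : lp.single 2 i (v i) = v i • basisVec i := by
      rw [basisVec, ← lp.single_smul, smul_eq_mul, mul_one]
    simp only [hi, map_smul]
    exact Submodule.smul_mem _ _ (Submodule.le_topologicalClosure _ (h1 k i))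
  have h3 : ∀ u, HilbertTensor.incl K u ∈ (finiteColumns K).topologicalClosure := by
    intro u
    induction u with
    | zero => simp
    | add u v hu hv => rw [map_add]; exact Submodule.add_mem _ hu hv
    | tmul k v => exact h2 k v
  rw [dense_iff_closure_eq, ← Submodule.topologicalClosure_coe, Set.eq_univ_iff_forall]
  exact fun v => closure_minimal (Set.range_subset_iff.2 h3)
    (Submodule.isClosed_topologicalClosure _) (HilbertTensor.denseRange_incl K v)

lemma norm_algTensorMap_map_le (T : C →L[ℂ] C) {M : ℝ} (hM : CBBound T M)
    (u : C ⊗[ℂ] (ell2 →L[ℂ] ell2)) :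
    ‖algTensorMap C (TensorProduct.map T.toLinearMap LinearMap.id u)‖ ≤
      max M 0 * ‖algTensorMap C u‖ := by
  set R := algTensorMap C (TensorProduct.map T.toLinearMap LinearMap.id u) with hR
  have key : ∀ v w : HilbertTensor K,
      ‖inner ℂ w (R v)‖ ≤ max M 0 * ‖algTensorMap C u‖ * ‖v‖ * ‖w‖ := by
    let P : Set (HilbertTensor K × HilbertTensor K) :=
      {p | ‖inner ℂ p.2 (R p.1)‖ ≤ max M 0 * ‖algTensorMap C u‖ * ‖p.1‖ * ‖p.2‖}
    have hc : IsClosed P := isClosed_le (by fun_prop) (by fun_prop)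
    have hd := (dense_finiteColumns (K := K)).prod (dense_finiteColumns (K := K))
    suffices hs : (finiteColumns K : Set (HilbertTensor K)) ×ˢ
        (finiteColumns K : Set (HilbertTensor K)) ⊆ P by
      intro v w
      have hm : (v, w) ∈ P := closure_minimal hs hc (hd (v, w))
      exact hm
    · rintro ⟨v, w⟩ ⟨⟨N₁, h₁⟩, ⟨N₂, h₂⟩⟩
      obtain ⟨ξ, hξ⟩ := h₁ (max N₁ N₂) (le_max_left _ _)
      obtain ⟨η, hη⟩ := h₂ (max N₁ N₂) (le_max_right _ _)
      generalize max N₁ N₂ = n at *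
      have hcor : ((corner n (TensorProduct.map T.toLinearMap LinearMap.id u)).map
          fun c => (c : K →L[ℂ] K)) = (corner n u).map fun c => (T c : K →L[ℂ] K) := by
        ext i j : 2
        simp only [corner, Matrix.map_apply, Matrix.of_apply, slice_map]
      change ‖inner ℂ w (R v)‖ ≤ max M 0 * ‖algTensorMap C u‖ * ‖v‖ * ‖w‖
      dsimp only at hξ hη
      rw [← hξ, ← hη, hR, inner_corner, norm_colIncl, norm_colIncl, hcor]
      have hb := (hM n (corner n u)).trans (mul_le_mul (le_max_left M 0) (norm_corner_le n u)
        (norm_nonneg _) (le_max_right M 0))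
      calc _ ≤ ‖η‖ * ‖blockOperator ((corner n u).map fun c => (T c : K →L[ℂ] K)) ξ‖ :=
            norm_inner_le_norm _ _
        _ ≤ ‖η‖ * (max M 0 * ‖algTensorMap C u‖ * ‖ξ‖) := by
            gcongr
            exact ContinuousLinearMap.le_of_opNorm_le _ hb _
        _ = _ := by ring
  refine ContinuousLinearMap.opNorm_le_bound _ (by positivity) fun v => ?_
  have h := key v (R v)
  rw [inner_self_eq_norm_sq_to_K] at h
  rcases (norm_nonneg (R v)).eq_or_lt with h0 | h0
  · rw [← h0]; positivity
  · refine le_of_mul_le_mul_right ?_ h0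
    simpa [sq] using h

/-- For completely bounded `T`, the map `T ⊗ id` does send `c ⊗ b` to `T c ⊗ b`. -/
theorem amplify_toMinTensor (T : CBMap C) (u : C ⊗[ℂ] (ell2 →L[ℂ] ell2)) :
    amplify (T : C →L[ℂ] C) (toMinTensor C u) =
      toMinTensor C (TensorProduct.map (T : C →L[ℂ] C).toLinearMap LinearMap.id u) := by
  obtain ⟨M, hM⟩ := T.2
  exact LinearMap.extendOfNorm_eq (denseRange_toMinTensor C)
    ⟨max M 0, fun u => norm_algTensorMap_map_le _ hM u⟩ u

lemma norm_vecSlice_le (ξ η : ell2) (u : C ⊗[ℂ] (ell2 →L[ℂ] ell2)) :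
    ∃ s : C, ‖s‖ ≤ ‖algTensorMap C u‖ * ‖ξ‖ * ‖η‖ ∧ ∀ φ : C →L[ℂ] ℂ,
      inner ℂ η (TensorProduct.lid ℂ _ (TensorProduct.map φ.toLinearMap LinearMap.id u) ξ) =
        φ s := by
  obtain ⟨s, h1, h2⟩ : ∃ s : C,
      (∀ k l : K, inner ℂ l ((s : K →L[ℂ] K) k) =
        inner ℂ (HilbertTensor.incl K (l ⊗ₜ η))
          (algTensorMap C u (HilbertTensor.incl K (k ⊗ₜ ξ)))) ∧
      ∀ φ : C →L[ℂ] ℂ,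
        inner ℂ η (TensorProduct.lid ℂ _ (TensorProduct.map φ.toLinearMap LinearMap.id u) ξ) =
          φ s := by
    induction u with
    | zero => exact ⟨0, by simp, by simp⟩
    | add u v hu hv =>
      obtain ⟨s, hs, hs'⟩ := hu
      obtain ⟨t, ht, ht'⟩ := hv
      refine ⟨s + t, fun k l => ?_, fun φ => ?_⟩
      · simp only [map_add, add_apply, inner_add_right, AddMemClass.coe_add, hs, ht]
      · simp only [map_add, add_apply, inner_add_right, hs', ht']
    | tmul c b =>
      refine ⟨inner ℂ η (b ξ) • c, fun k l => ?_, fun φ => ?_⟩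
      · rw [algTensorMap_tmul, opTensor_incl, LinearIsometry.inner_map_map]
        simp [TensorProduct.inner_tmul, mul_comm]
      · simp [mul_comm]
  refine ⟨s, ?_, h2⟩
  refine ContinuousLinearMap.opNorm_le_bound _ (by positivity) fun k => ?_
  set l := (s : K →L[ℂ] K) k with hl
  have hb : ‖l‖ * ‖l‖ ≤ (‖algTensorMap C u‖ * ‖ξ‖ * ‖η‖ * ‖k‖) * ‖l‖ := by
    have h3 := h1 k l
    rw [← hl, inner_self_eq_norm_sq_to_K] at h3
    have h4 : ‖l‖ * ‖l‖ = ‖inner ℂ (HilbertTensor.incl K (l ⊗ₜ η))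
          (algTensorMap C u (HilbertTensor.incl K (k ⊗ₜ ξ)))‖ := by
      rw [← h3]; simp [sq]
    rw [h4]
    refine (norm_inner_le_norm _ _).trans ?_
    rw [LinearIsometry.norm_map, TensorProduct.norm_tmul]
    calc _ ≤ ‖l‖ * ‖η‖ * (‖algTensorMap C u‖ * (‖k‖ * ‖ξ‖)) := by
          gcongr
          refine (ContinuousLinearMap.le_opNorm _ _).trans_eq ?_
          rw [LinearIsometry.norm_map, TensorProduct.norm_tmul]
      _ = _ := by ring
  change ‖l‖ ≤ _
  rcases (norm_nonneg l).eq_or_lt with h0 | h0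
  · rw [← h0]; positivity
  · exact le_of_mul_le_mul_right hb h0

lemma norm_opTensor_le (c : K →L[ℂ] K) (b : ell2 →L[ℂ] ell2) :
    ‖opTensor c b‖ ≤ ‖c‖ * ‖b‖ := by
  refine ContinuousLinearMap.opNorm_le_bound _ (by positivity) fun v => ?_
  refine (HilbertTensor.denseRange_incl K).induction_on (p := fun v =>
    ‖opTensor c b v‖ ≤ ‖c‖ * ‖b‖ * ‖v‖) v (isClosed_le (by fun_prop) (by fun_prop)) fun v => ?_
  rw [opTensor_incl, LinearIsometry.norm_map, LinearIsometry.norm_map]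
  exact ContinuousLinearMap.le_of_opNorm_le _ (TensorProduct.norm_mapL_le c b) v

/-- A bounded map of rank one is tensored with the identity without loss of norm. -/
lemma norm_algTensorMap_map_smulRight_le (φ : C →L[ℂ] ℂ) (c : C)
    (u : C ⊗[ℂ] (ell2 →L[ℂ] ell2)) :
    ‖algTensorMap C (TensorProduct.map (φ.smulRight c).toLinearMap LinearMap.id u)‖ ≤
      ‖φ‖ * ‖c‖ * ‖algTensorMap C u‖ := by
  set b := TensorProduct.lid ℂ _ (TensorProduct.map φ.toLinearMap LinearMap.id u) with hb
  have h1 : algTensorMap C (TensorProduct.map (φ.smulRight c).toLinearMap LinearMap.id u) =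
      opTensor (c : K →L[ℂ] K) b := by
    rw [hb, ← algTensorMap_tmul]
    congr 1
    clear hb b
    induction u with
    | zero => simp
    | add u v hu hv => simp only [map_add, hu, hv, TensorProduct.tmul_add]
    | tmul d b => simp [TensorProduct.smul_tmul]
  have h2 : ‖b‖ ≤ ‖φ‖ * ‖algTensorMap C u‖ := by
    refine ContinuousLinearMap.opNorm_le_bound _ (by positivity) fun ξ => ?_
    obtain ⟨s, hs, hs'⟩ := norm_vecSlice_le ξ (b ξ) u
    have h3 := hs' φ
    rw [← hb, inner_self_eq_norm_sq_to_K] at h3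
    have h4 : ‖b ξ‖ * ‖b ξ‖ ≤ ‖φ‖ * ‖algTensorMap C u‖ * ‖ξ‖ * ‖b ξ‖ := by
      have h5 : ‖b ξ‖ * ‖b ξ‖ = ‖φ s‖ := by rw [← h3]; simp [sq]
      rw [h5]
      refine (φ.le_opNorm s).trans ?_
      calc _ ≤ ‖φ‖ * (‖algTensorMap C u‖ * ‖ξ‖ * ‖b ξ‖) := by gcongr
        _ = _ := by ring
    rcases (norm_nonneg (b ξ)).eq_or_lt with h0 | h0
    · rw [← h0]; positivity
    · exact le_of_mul_le_mul_right h4 h0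
  rw [h1]
  calc _ ≤ ‖(c : K →L[ℂ] K)‖ * ‖b‖ := norm_opTensor_le _ _
    _ ≤ ‖(c : K →L[ℂ] K)‖ * (‖φ‖ * ‖algTensorMap C u‖) := by gcongr
    _ = _ := by change ‖c‖ * _ = _; ring

/-- A bounded map of finite rank is a finite sum of bounded maps of rank one. -/
lemma exists_eq_sum_smulRight (T : C →L[ℂ] C)
    (hT : FiniteDimensional ℂ (LinearMap.range T.toLinearMap)) :
    ∃ (n : ℕ) (φ : Fin n → C →L[ℂ] ℂ) (c : Fin n → C), ∀ x, T x = ∑ k, φ k x • c k := by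
  let bs := Module.finBasis ℂ (LinearMap.range T.toLinearMap)
  refine ⟨_, fun k => (bs.coord k).toContinuousLinearMap ∘L
    T.codRestrict (LinearMap.range T.toLinearMap)
      (fun c => LinearMap.mem_range_self T.toLinearMap c), fun k => (bs k : C), fun x => ?_⟩
  have h := congrArg Subtype.val (bs.sum_repr ⟨T x, LinearMap.mem_range_self T.toLinearMap x⟩)
  rw [AddSubmonoidClass.coe_finsetSum] at h
  exact h.symm

/-- For bounded `T` of finite rank, the map `T ⊗ id` does send `c ⊗ b` to `T c ⊗ b`. -/
theorem amplify_toMinTensor_of_finiteRank (T : C →L[ℂ] C)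
    (hT : FiniteDimensional ℂ (LinearMap.range T.toLinearMap))
    (u : C ⊗[ℂ] (ell2 →L[ℂ] ell2)) :
    amplify T (toMinTensor C u) =
      toMinTensor C (TensorProduct.map T.toLinearMap LinearMap.id u) := by
  obtain ⟨n, φ, d, hsum⟩ := exists_eq_sum_smulRight T hT
  refine LinearMap.extendOfNorm_eq (denseRange_toMinTensor C)
    ⟨∑ k, ‖φ k‖ * ‖d k‖, fun u => ?_⟩ u
  change ‖algTensorMap C (TensorProduct.map T.toLinearMap LinearMap.id u)‖ ≤
    _ * ‖algTensorMap C u‖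
  have h1 : TensorProduct.map T.toLinearMap LinearMap.id u =
      ∑ k, TensorProduct.map ((φ k).smulRight (d k)).toLinearMap
        (LinearMap.id : (ell2 →L[ℂ] ell2) →ₗ[ℂ] _) u := by
    induction u with
    | zero => simp
    | add u v hu hv => simp only [map_add, hu, hv, Finset.sum_add_distrib]
    | tmul c b =>
      simp only [TensorProduct.map_tmul, ← TensorProduct.sum_tmul]
      exact congrArg (· ⊗ₜ b) (hsum c)
  rw [h1, map_sum, Finset.sum_mul]
  exact (norm_sum_le _ _).trans
    (Finset.sum_le_sum fun k _ => norm_algTensorMap_map_smulRight_le _ _ _)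

lemma amplify_add (S T : CBMap C) : amplify ((S + T : CBMap C) : C →L[ℂ] C) =
    amplify (S : C →L[ℂ] C) + amplify (T : C →L[ℂ] C) := by
  refine ContinuousLinearMap.coeFn_injective <| (denseRange_toMinTensor C).equalizer
    (ContinuousLinearMap.continuous _) (ContinuousLinearMap.continuous _) (funext fun u => ?_)
  simp only [Function.comp_apply, add_apply, amplify_toMinTensor, ← map_add]
  congr 1
  induction u with
  | zero => simp
  | add u v hu hv => simp only [map_add] at *; rw [hu, hv]; abel
  | tmul c b => simp [TensorProduct.add_tmul]

lemma amplify_smul (z : ℂ) (T : CBMap C) : amplify ((z • T : CBMap C) : C →L[ℂ] C) =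
    z • amplify (T : C →L[ℂ] C) := by
  refine ContinuousLinearMap.coeFn_injective <| (denseRange_toMinTensor C).equalizer
    (ContinuousLinearMap.continuous _) (ContinuousLinearMap.continuous _) (funext fun u => ?_)
  simp only [Function.comp_apply, smul_apply, amplify_toMinTensor, ← map_smul]
  congr 1
  induction u with
  | zero => simp
  | add u v hu hv => simp only [map_add, smul_add] at *; rw [hu, hv]
  | tmul c b => simp [TensorProduct.smul_tmul']

/-- The functional `ω_{x,ψ}(T) = ψ((T ⊗ id) x)` on `CB(C)`, for `x ∈ C ⊗ B(ℓ²)` and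
`ψ ∈ (C ⊗ B(ℓ²))^*`. -/
def omega (x : minTensor C) (ψ : minTensor C →L[ℂ] ℂ) : CBMap C →ₗ[ℂ] ℂ where
  toFun T := ψ (amplify (T : C →L[ℂ] C) x)
  map_add' S T := by rw [amplify_add, add_apply, map_add]
  map_smul' z T := by rw [amplify_smul, smul_apply, map_smul, RingHom.id_apply]

end Tensor

/-! ### The strong operator approximation property -/

/-- A concrete C*-algebra `C ⊆ B(K)` has the strong operator approximation property (SOAP): there
is a net `(Φᵢ)` of bounded finite rank maps on `C` with `(Φᵢ ⊗ id) x → x` in norm for every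
`x ∈ C ⊗ B(ℓ²)`. -/
def HasSOAP {K : Type u} [NormedAddCommGroup K] [InnerProductSpace ℂ K] [CompleteSpace K]
    (C : StarSubalgebra ℂ (K →L[ℂ] K)) : Prop :=
  ∃ (ι : Type u) (_ : Preorder ι) (_ : IsDirected ι (· ≤ ·)) (_ : Nonempty ι)
    (Φ : ι → C →L[ℂ] C),
    (∀ i, FiniteDimensional ℂ (LinearMap.range (Φ i).toLinearMap)) ∧
    ∀ x : minTensor C, Tendsto (fun i => amplify (Φ i) x) atTop (𝓝 x)

section CrossedProduct

variable {G : Type*} [Group G] {H : Type*} [NormedAddCommGroup H] [InnerProductSpace ℂ H]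

variable (H) in
/-- The left translation `λ_r` on `ℓ²(G, H)`: `(λ_r ξ)(s) = ξ(r⁻¹ s)`. -/
def lam (r : G) : lp (fun _ : G => H) 2 →L[ℂ] lp (fun _ : G => H) 2 :=
  LinearMap.mkContinuous
    { toFun := fun ξ => ⟨fun s => ξ (r⁻¹ * s), memℓp_gen <|
        (Equiv.mulLeft r⁻¹).summable_iff.2 ((lp.memℓp ξ).summable (by norm_num))⟩
      map_add' := fun ξ η => by ext; rfl
      map_smul' := fun a ξ => by ext; rfl } 1 (fun ξ => by
        rw [one_mul, lp.norm_eq_tsum_rpow (by norm_num), lp.norm_eq_tsum_rpow (by norm_num)]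
        exact le_of_eq (congrArg (· ^ _)
          ((Equiv.mulLeft r⁻¹).tsum_eq fun s => ‖ξ s‖ ^ (2 : ENNReal).toReal)))

@[simp] lemma lam_apply (r : G) (ξ : lp (fun _ : G => H) 2) (s : G) :
    lam H r ξ s = ξ (r⁻¹ * s) := rfl

variable [CompleteSpace H] {A : StarSubalgebra ℂ (H →L[ℂ] H)} [IsClosed (A : Set (H →L[ℂ] H))]
  (α : G →* (A ≃⋆ₐ[ℂ] A))

lemma norm_action_le (s : G) (a : A) : ‖((α s a : A) : H →L[ℂ] H)‖ ≤ ‖a‖ :=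
  NonUnitalStarAlgHom.norm_apply_le (α s) a

/-- The representation `π` of `A` on `ℓ²(G, H)`: `(π(a) ξ)(s) = α_{s⁻¹}(a) ξ(s)`. -/
def piRep (a : A) : lp (fun _ : G => H) 2 →L[ℂ] lp (fun _ : G => H) 2 :=
  lp.mapCLM 2 (fun s => ((α s⁻¹ a : A) : H →L[ℂ] H)) (norm_nonneg a)
    (fun s => norm_action_le α s⁻¹ a)

@[simp] lemma piRep_apply (a : A) (ξ : lp (fun _ : G => H) 2) (s : G) :
    piRep α a ξ s = ((α s⁻¹ a : A) : H →L[ℂ] H) (ξ s) := rfl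

lemma norm_piRep_le (a : A) : ‖piRep α a‖ ≤ ‖a‖ :=
  lp.norm_mapCLM_le 2 _ (norm_nonneg a) _

lemma norm_lam_le (r : G) : ‖lam H r‖ ≤ 1 := LinearMap.mkContinuous_norm_le _ zero_le_one _

lemma lam_mul_piRep (r : G) (a : A) : lam H r * piRep α a = piRep α (α r a) * lam H r := by
  ext ξ s
  simp [ContinuousLinearMap.mul_def, mul_inv_rev]

lemma lam_mul_lam (r s : G) : lam H r * lam H s = lam H (r * s) := by
  ext ξ t
  simp [ContinuousLinearMap.mul_def, mul_assoc]

lemma piRep_mul (a b : A) : piRep α (a * b) = piRep α a * piRep α b := by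
  ext ξ s
  simp [ContinuousLinearMap.mul_def]

lemma piRep_one : piRep α 1 = 1 := by
  ext ξ s
  simp

lemma piRep_add (a b : A) : piRep α (a + b) = piRep α a + piRep α b := by
  ext ξ s
  simp

lemma piRep_smul (z : ℂ) (a : A) : piRep α (z • a) = z • piRep α a := by
  ext ξ s
  simp

lemma lam_one : lam H (1 : G) = 1 := by
  ext ξ s
  simp

lemma star_lam (r : G) : star (lam H r) = lam H r⁻¹ := by
  rw [ContinuousLinearMap.star_eq_adjoint, eq_comm, ContinuousLinearMap.eq_adjoint_iff]
  intro ξ η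
  rw [lp.inner_eq_tsum, lp.inner_eq_tsum,
    ← (Equiv.mulLeft r⁻¹).tsum_eq fun s => inner ℂ ((lam H r⁻¹ ξ : lp (fun _ : G => H) 2) s) (η s)]
  simp

lemma star_piRep (a : A) : star (piRep α a) = piRep α (star a) := by
  rw [ContinuousLinearMap.star_eq_adjoint, eq_comm, ContinuousLinearMap.eq_adjoint_iff]
  intro ξ η
  rw [lp.inner_eq_tsum, lp.inner_eq_tsum]
  refine tsum_congr fun s => ?_
  rw [piRep_apply, piRep_apply, map_star, StarMemClass.coe_star,
    ContinuousLinearMap.star_eq_adjoint, ContinuousLinearMap.adjoint_inner_left]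

/-- The integrated form `π ⋊ λ (f) = ∑_s π(f(s)) λ_s` for `f : G → A`; the sum converges in norm
when `f ∈ ℓ¹(G, A)`. -/
def integratedForm (f : G → A) : lp (fun _ : G => H) 2 →L[ℂ] lp (fun _ : G => H) 2 :=
  ∑' s, piRep α (f s) * lam H s

lemma summable_integratedForm {f : G → A} (hf : Summable fun s => ‖f s‖) :
    Summable fun s => piRep α (f s) * lam H s := by
  refine Summable.of_norm_bounded hf fun s => (norm_mul_le _ _).trans ?_
  exact (mul_le_mul (norm_piRep_le α _) (norm_lam_le s) (norm_nonneg _) (norm_nonneg _)).trans_eq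
    (mul_one _)

variable (G A) in
/-- `ℓ¹(G, A)`: the functions `f : G → A` with `∑_s ‖f(s)‖ < ∞`. -/
def l1 : Set (G → A) := {f | Summable fun s => ‖f s‖}

/-- The *-algebra of finite sums `∑ π(a_s) λ_s`. -/
def finiteSums : StarSubalgebra ℂ (lp (fun _ : G => H) 2 →L[ℂ] lp (fun _ : G => H) 2) where
  carrier := Submodule.span ℂ {x | ∃ (a : A) (r : G), x = piRep α a * lam H r}
  add_mem' := Submodule.add_mem _
  zero_mem' := Submodule.zero_mem _
  one_mem' := Submodule.subset_span ⟨1, 1, by rw [piRep_one, lam_one, one_mul]⟩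
  algebraMap_mem' := fun z => by
    rw [Algebra.algebraMap_eq_smul_one]
    exact Submodule.smul_mem _ _
      (Submodule.subset_span ⟨1, 1, by rw [piRep_one, lam_one, one_mul]⟩)
  mul_mem' := by
    intro x y hx hy
    have h := Submodule.mul_mem_mul hx hy
    rw [Submodule.span_mul_span] at h
    refine Submodule.span_mono ?_ h
    rintro _ ⟨_, ⟨a, r, rfl⟩, _, ⟨b, s, rfl⟩, rfl⟩
    refine ⟨a * α r b, r * s, ?_⟩
    change piRep α a * lam H r * (piRep α b * lam H s) = _
    rw [mul_assoc, ← mul_assoc (lam H r), lam_mul_piRep, piRep_mul, ← lam_mul_lam]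
    simp only [mul_assoc]
  star_mem' := by
    intro x hx
    refine Submodule.span_induction ?_ ?_ ?_ ?_ hx
    · rintro _ ⟨a, r, rfl⟩
      refine Submodule.subset_span ⟨α r⁻¹ (star a), r⁻¹, ?_⟩
      rw [star_mul, star_lam, star_piRep, lam_mul_piRep]
    · rw [star_zero]; exact Submodule.zero_mem _
    · intro x y _ _ hx hy
      rw [star_add]; exact Submodule.add_mem _ hx hy
    · intro z x _ hx
      rw [star_smul]; exact Submodule.smul_mem _ _ hx

lemma closure_image_integratedForm :
    closure (integratedForm α '' l1 G A) = ((finiteSums α).topologicalClosure : Set _) := by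
  rw [StarSubalgebra.topologicalClosure_coe]
  apply Set.Subset.antisymm
  · refine closure_minimal ?_ isClosed_closure
    rintro _ ⟨f, hf, rfl⟩
    refine isClosed_closure.mem_of_tendsto (summable_integratedForm α hf).hasSum
      (Filter.Eventually.of_forall fun t => subset_closure ?_)
    exact Submodule.sum_mem _ fun s _ => Submodule.subset_span ⟨f s, s, rfl⟩
  · have h0 : piRep α (0 : A) = 0 := by simpa using piRep_smul α 0 (0 : A)
    refine closure_mono fun x hx => ?_
    refine Submodule.span_induction ?_ ?_ ?_ ?_ hx
    · classical
      rintro _ ⟨a, r, rfl⟩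
      have hs : ∀ s, s ≠ r → Pi.single (M := fun _ => A) r a s = 0 := fun s hs => by simp [hs]
      refine ⟨Pi.single r a, ?_, ?_⟩
      · exact summable_of_ne_finset_zero (s := {r}) fun s hsr => by
          rw [hs s (by simpa using hsr), norm_zero]
      · rw [integratedForm, tsum_eq_single r fun s hsr => by rw [hs s hsr, h0, zero_mul],
          Pi.single_eq_same]
    · refine ⟨0, ?_, ?_⟩
      · exact summable_of_ne_finset_zero (s := ∅) fun s _ => norm_zero
      · simp [integratedForm, h0]
    · rintro _ _ _ _ ⟨f, hf, rfl⟩ ⟨g, hg, rfl⟩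
      refine ⟨f + g, Summable.of_nonneg_of_le (fun _ => norm_nonneg _)
        (fun _ => norm_add_le _ _) (hf.add hg), ?_⟩
      simp only [integratedForm, Pi.add_apply, piRep_add, add_mul]
      exact (summable_integratedForm α hf).tsum_add (summable_integratedForm α hg)
    · rintro z _ _ ⟨f, hf, rfl⟩
      refine ⟨z • f, Summable.of_nonneg_of_le (fun _ => norm_nonneg _)
        (fun s => norm_smul_le z (f s : H →L[ℂ] H)) (hf.mul_left ‖z‖), ?_⟩
      simp only [integratedForm, Pi.smul_apply, piRep_smul, smul_mul_assoc]
      exact (summable_integratedForm α hf).tsum_const_smul z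

/-- The reduced crossed product `A ⋊_{α,r} G ⊆ B(ℓ²(G, H))`: the norm closure of
`π ⋊ λ (ℓ¹(G, A))`. -/
def reducedCrossedProduct :
    StarSubalgebra ℂ (lp (fun _ : G => H) 2 →L[ℂ] lp (fun _ : G => H) 2) :=
  (finiteSums α).topologicalClosure.copy (closure (integratedForm α '' l1 G A))
    (closure_image_integratedForm α)

lemma isClosed_reducedCrossedProduct : IsClosed (reducedCrossedProduct α : Set
    (lp (fun _ : G => H) 2 →L[ℂ] lp (fun _ : G => H) 2)) := isClosed_closure

lemma integratedForm_mem {f : G → A} (hf : f ∈ l1 G A) :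
    integratedForm α f ∈ reducedCrossedProduct α := subset_closure ⟨f, hf, rfl⟩

/-! ### Herz–Schur multipliers -/

/-- `S = S_F`: the map `S` on `A ⋊_{α,r} G` satisfies `S(π ⋊ λ (f)) = π ⋊ λ (F · f)` for all
`f ∈ ℓ¹(G, A)`, where `(F · f)(r) = F(r)(f(r))`. -/
def IsMultiplierMap (F : G → CBMap A) (S : CBMap (reducedCrossedProduct α)) : Prop :=
  ∀ (f : G → A) (hf : f ∈ l1 G A),
    ((S : reducedCrossedProduct α →L[ℂ] reducedCrossedProduct α)
      ⟨integratedForm α f, integratedForm_mem α hf⟩ : lp (fun _ : G => H) 2 →L[ℂ] _) =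
      integratedForm α fun r => (F r : A →L[ℂ] A) (f r)

/-- `F : G → CB(A)` is a Herz–Schur `(A, G, α)`-multiplier: it is bounded for the cb norm, and
`π ⋊ λ (f) ↦ π ⋊ λ (F · f)` extends to a completely bounded map `S_F` on `A ⋊_{α,r} G`. -/
structure IsHerzSchurMultiplier (F : G → CBMap A) : Prop where
  bounded : ∃ M : ℝ, ∀ r, CBBound (F r : A →L[ℂ] A) M
  extends_cb : ∃ S : CBMap (reducedCrossedProduct α), IsMultiplierMap α F S

/-- The space of Herz–Schur `(A, G, α)`-multipliers. -/
def HerzSchurMultiplier : Type _ := {F : G → CBMap A // IsHerzSchurMultiplier α F}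

variable {α} in
/-- The completely bounded map `S_F` on `A ⋊_{α,r} G` of a Herz–Schur multiplier `F`. -/
def HerzSchurMultiplier.toCBMap (F : HerzSchurMultiplier α) : CBMap (reducedCrossedProduct α) :=
  F.2.extends_cb.choose

lemma HerzSchurMultiplier.isMultiplierMap_toCBMap (F : HerzSchurMultiplier α) :
    IsMultiplierMap α F.1 F.toCBMap := F.2.extends_cb.choose_spec

/-- `S_F` is uniquely determined by `F`. -/
lemma IsMultiplierMap.unique {F : G → CBMap A} {S T : CBMap (reducedCrossedProduct α)}
    (hS : IsMultiplierMap α F S) (hT : IsMultiplierMap α F T) : S = T := by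
  refine Subtype.ext (ContinuousLinearMap.ext fun x => ?_)
  have hx : x ∈ closure (Subtype.val ⁻¹' (integratedForm α '' l1 G A) :
      Set (reducedCrossedProduct α)) := by
    rw [Metric.mem_closure_iff]
    intro ε hε
    obtain ⟨_, ⟨f, hf, rfl⟩, hd⟩ := Metric.mem_closure_iff.1 (show (x : _ →L[ℂ] _) ∈
      closure (integratedForm α '' l1 G A) from x.2) ε hε
    exact ⟨⟨integratedForm α f, integratedForm_mem α hf⟩, ⟨f, hf, rfl⟩, hd⟩
  have hc : IsClosed {x : reducedCrossedProduct α |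
      (S : reducedCrossedProduct α →L[ℂ] reducedCrossedProduct α) x =
        (T : reducedCrossedProduct α →L[ℂ] reducedCrossedProduct α) x} :=
    isClosed_eq (ContinuousLinearMap.continuous _) (ContinuousLinearMap.continuous _)
  refine closure_minimal ?_ hc hx
  rintro ⟨_, _⟩ ⟨f, hf, rfl⟩
  exact Subtype.ext ((hS f hf).trans (hT f hf).symm)

/-! ### The approximation property of a C*-dynamical system -/

/-- The space `Q(A, G, α)` of functionals `ω_{x,ψ}` with `x ∈ (A ⋊_{α,r} G) ⊗ B(ℓ²)` and
`ψ ∈ ((A ⋊_{α,r} G) ⊗ B(ℓ²))^*`. -/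
def Q : Set (CBMap (reducedCrossedProduct α) →ₗ[ℂ] ℂ) :=
  {ω | ∃ x ψ, ω = omega x ψ}

end CrossedProduct

/-- The C*-dynamical system `(A, G, α)` has the approximation property (AP): there is a net of
finitely supported Herz–Schur `(A, G, α)`-multipliers `Fᵢ`, with every `Fᵢ(r)` of finite rank, such
that `ω(Fᵢ) := ω(S_{Fᵢ}) → ω(id)` for every `ω ∈ Q(A, G, α)`. -/
def HasAP {H : Type u} [NormedAddCommGroup H] [InnerProductSpace ℂ H] [CompleteSpace H]
    {G : Type v} [Group G] {A : StarSubalgebra ℂ (H →L[ℂ] H)} [IsClosed (A : Set (H →L[ℂ] H))]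
    (α : G →* (A ≃⋆ₐ[ℂ] A)) : Prop :=
  ∃ (ι : Type (max u v)) (_ : Preorder ι) (_ : IsDirected ι (· ≤ ·)) (_ : Nonempty ι)
    (F : ι → HerzSchurMultiplier α),
    (∀ i, {r : G | (F i).1 r ≠ 0}.Finite) ∧
    (∀ i r, FiniteDimensional ℂ
      (LinearMap.range ((F i).1 r : A →L[ℂ] A).toLinearMap)) ∧
    ∀ ω ∈ Q α, Tendsto (fun i => ω (F i).toCBMap) atTop
      (𝓝 (ω (CBMap.id (reducedCrossedProduct α))))

end CrossedProductAP

end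

/-!
If the system has the AP, each `S_F` has finite rank, so the identity of `A ⋊ G` is approximated by
finite rank maps in the weak sense; a convexity argument (Hahn–Banach) upgrades weak to norm
convergence on every finite set of tensors.

Conversely, let `Φ` be a finite rank map approximating the identity. As the elements `π(a) λ_g` span
a dense subspace, the range of `Φ` may be moved into that span, and then
`F(g)(a) = E_g(Φ(π(a) λ_g))`, with `E_g` the `g`-th Fourier coefficient, is a finitely supported
multiplier. Its multiplier map is a compression of `Φ`: an `x ∈ (A ⋊ G) ⊗ B(ℓ²)` is supported on a
countable subgroup `Γ`, so `B(ℓ²)` has room for the regular representation of `Γ`, and by Fell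
absorption `z = (π(a) λ_g ⊗ λ_g ⊗ b)` determines `x`. Removing the second leg keeps exactly the
diagonal terms of `(Φ ⊗ id)(z)`, whence `‖(S_F ⊗ id) x - x‖ ≤ ‖(Φ ⊗ id) z - z‖`.
-/

noncomputable section

namespace CrossedProductAP

local notation "ℓ²(" G "," H ")" => lp (fun _ : G => H) 2

section ColumnContraction

variable {𝕜 I E F E' F' : Type*} [RCLike 𝕜]
  [NormedAddCommGroup E] [InnerProductSpace 𝕜 E] [NormedAddCommGroup F] [InnerProductSpace 𝕜 F]
  [NormedAddCommGroup E'] [InnerProductSpace 𝕜 E'] [NormedAddCommGroup F'] [InnerProductSpace 𝕜 F']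

/-- A family of operators `Tᵢ : E → F` which is contractive as a column `E → ℓ²(I,F)`. -/
def IsColumnContraction (T : I → E →L[𝕜] F) : Prop :=
  ∀ (s : Finset I) (v : E), ∑ i ∈ s, ‖T i v‖ ^ 2 ≤ ‖v‖ ^ 2

namespace IsColumnContraction

variable {T : I → E →L[𝕜] F} {S : I → E' →L[𝕜] F'}

lemma norm_le (hT : IsColumnContraction T) (i : I) : ‖T i‖ ≤ 1 := by
  refine ContinuousLinearMap.opNorm_le_bound _ zero_le_one fun v => ?_
  rw [one_mul]
  exact (sq_le_sq₀ (norm_nonneg _) (norm_nonneg _)).1 (by simpa using hT {i} v)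

lemma comp_injective {J : Type*} (hT : IsColumnContraction T) {e : J → I}
    (he : Function.Injective e) : IsColumnContraction fun j => T (e j) := fun s v => by
  simpa using hT (s.map ⟨e, he⟩) v

lemma conj_linearIsometryEquiv {E₁ F₁ : Type*} [NormedAddCommGroup E₁] [InnerProductSpace 𝕜 E₁]
    [NormedAddCommGroup F₁] [InnerProductSpace 𝕜 F₁] (hT : IsColumnContraction T)
    (e : E₁ ≃ₗᵢ[𝕜] E) (f : F ≃ₗᵢ[𝕜] F₁) :
    IsColumnContraction fun i =>
      (f : F →L[𝕜] F₁) ∘L T i ∘L (e : E₁ →L[𝕜] E) := fun s v => by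
  simpa using hT s (e v)

/-- The column `v ↦ (Tᵢ v)ᵢ` as an operator. -/
def column (hT : IsColumnContraction T) : E →L[𝕜] ℓ²(I,F) :=
  LinearMap.mkContinuous
    { toFun := fun v => ⟨fun i => T i v, memℓp_gen' (C := ‖v‖ ^ 2) fun s => by
        simpa using hT s v⟩
      map_add' := fun v w => by ext i; exact map_add (T i) v w
      map_smul' := fun a v => by ext i; exact map_smul (T i) a v } 1 fun v => by
        rw [one_mul]
        exact lp.norm_le_of_forall_sum_le (by norm_num) (norm_nonneg v) fun s => by
          simpa using hT s v

lemma norm_column_le (hT : IsColumnContraction T) : ‖hT.column‖ ≤ 1 :=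
  LinearMap.mkContinuous_norm_le _ zero_le_one _

end IsColumnContraction

/-- The diagonal operator `X ⊕ X ⊕ ⋯` on `ℓ²(I,F)`, as a linear function of `X`. -/
def constDiagonal (𝕜 I F F' : Type*) [RCLike 𝕜] [NormedAddCommGroup F] [InnerProductSpace 𝕜 F]
    [NormedAddCommGroup F'] [InnerProductSpace 𝕜 F'] :
    (F →L[𝕜] F') →L[𝕜] (ℓ²(I,F) →L[𝕜] ℓ²(I,F')) :=
  LinearMap.mkContinuous
    { toFun := fun X => lp.mapCLM 2 (fun _ : I => X) (norm_nonneg X) (fun _ => le_rfl)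
      map_add' := fun _ _ => rfl
      map_smul' := fun _ _ => rfl } 1 fun X => by
        rw [one_mul]
        exact lp.norm_mapCLM_le 2 (fun _ : I => X) (norm_nonneg X) fun _ => le_rfl

lemma norm_constDiagonal_le : ‖constDiagonal 𝕜 I F F'‖ ≤ 1 :=
  LinearMap.mkContinuous_norm_le _ zero_le_one _

namespace IsColumnContraction

variable {T : I → E →L[𝕜] F} {S : I → E' →L[𝕜] F'} [CompleteSpace E'] [CompleteSpace F']

/-- The map `X ↦ ∑ᵢ Sᵢ* X Tᵢ` from `B(F, F')` to `B(E, E')` given by two contractive columns. -/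
def sandwich (hS : IsColumnContraction S) (hT : IsColumnContraction T) :
    (F →L[𝕜] F') →L[𝕜] (E →L[𝕜] E') :=
  hS.column.adjoint.postcomp E ∘L hT.column.precomp ℓ²(I,F') ∘L constDiagonal 𝕜 I F F'

lemma norm_sandwich_le (hS : IsColumnContraction S) (hT : IsColumnContraction T) :
    ‖hS.sandwich hT‖ ≤ 1 := by
  have hS' : ‖hS.column.adjoint‖ ≤ 1 :=
    (LinearIsometryEquiv.norm_map _ _).trans_le hS.norm_column_le
  refine ContinuousLinearMap.opNorm_le_bound _ zero_le_one fun X => ?_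
  calc ‖hS.column.adjoint ∘L constDiagonal 𝕜 I F F' X ∘L hT.column‖
      ≤ ‖hS.column.adjoint‖ * (‖constDiagonal 𝕜 I F F' X‖ * ‖hT.column‖) :=
        (ContinuousLinearMap.opNorm_comp_le _ _).trans <| by
          gcongr
          exact ContinuousLinearMap.opNorm_comp_le _ _
    _ ≤ 1 * ((1 * ‖X‖) * 1) := by
        gcongr
        · exact (constDiagonal 𝕜 I F F').le_of_opNorm_le norm_constDiagonal_le X
        · exact hT.norm_column_le
    _ = 1 * ‖X‖ := by ring

lemma inner_sandwich (hS : IsColumnContraction S) (hT : IsColumnContraction T) (X : F →L[𝕜] F')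
    (v : E) (w : E') :
    inner 𝕜 w (hS.sandwich hT X v) = ∑' i, inner 𝕜 (S i w) (X (T i v)) := by
  change inner 𝕜 w (hS.column.adjoint _) = _
  rw [ContinuousLinearMap.adjoint_inner_right, lp.inner_eq_tsum]
  rfl

end IsColumnContraction

lemma hasSum_norm_sq {E : I → Type*} [∀ i, NormedAddCommGroup (E i)] (f : lp E 2) :
    HasSum (fun i => ‖f i‖ ^ 2) (‖f‖ ^ 2) := by
  simpa using lp.hasSum_norm (p := 2) (by norm_num) f

lemma isColumnContraction_mapCLM {J : Type*} {E F : J → Type*}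
    [∀ j, NormedAddCommGroup (E j)] [∀ j, InnerProductSpace 𝕜 (E j)]
    [∀ j, NormedAddCommGroup (F j)] [∀ j, InnerProductSpace 𝕜 (F j)]
    {T : ∀ j, I → E j →L[𝕜] F j} (hT : ∀ j, IsColumnContraction (T j)) :
    IsColumnContraction fun i =>
      lp.mapCLM 2 (fun j => T j i) zero_le_one fun j => (hT j).norm_le i := by
  intro s x
  refine hasSum_le (fun j => hT j s (x j)) (hasSum_sum fun i _ => ?_) (hasSum_norm_sq x)
  have h := hasSum_norm_sq (lp.mapCLM 2 (fun j => T j i) zero_le_one (fun j => (hT j).norm_le i) x)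
  simp only [lp.mapCLM_apply_coe] at h
  exact h

lemma isColumnContraction_iff_sum_adjoint_comp_le_one [CompleteSpace E] [CompleteSpace F]
    {T : I → E →L[𝕜] F} :
    IsColumnContraction T ↔ ∀ s : Finset I, ∑ i ∈ s, (T i).adjoint ∘L T i ≤ 1 := by
  refine forall_congr' fun s => ?_
  have hsum : (∑ i ∈ s, (T i).adjoint ∘L T i).IsPositive :=
    ContinuousLinearMap.isPositive_sum s fun i _ =>
      ContinuousLinearMap.isPositive_adjoint_comp_self (T i)
  rw [ContinuousLinearMap.le_def, ContinuousLinearMap.isPositive_def', and_iff_right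
    (ContinuousLinearMap.isPositive_one.isSelfAdjoint.sub hsum.isSelfAdjoint)]
  refine forall_congr' fun v => ?_
  simp [ContinuousLinearMap.reApplyInnerSelf_apply, inner_sub_left, sum_inner,
    ContinuousLinearMap.adjoint_inner_left]

end ColumnContraction

section OrthogonalFamily

variable {𝕜 I E : Type*} {F : I → Type*} [RCLike 𝕜] [NormedAddCommGroup E]
  [InnerProductSpace 𝕜 E] [CompleteSpace E] [∀ i, NormedAddCommGroup (F i)]
  [∀ i, InnerProductSpace 𝕜 (F i)] [∀ i, CompleteSpace (F i)] {V : ∀ i, F i →ₗᵢ[𝕜] E}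

lemma orthogonalFamily_iff_adjoint_comp_eq_zero :
    OrthogonalFamily 𝕜 F V ↔ Pairwise fun i j =>
      (V i).toContinuousLinearMap.adjoint ∘L (V j).toContinuousLinearMap = 0 := by
  refine forall₃_congr fun i j _ => ⟨fun h => ?_, fun h v w => ?_⟩
  · ext w
    refine ext_inner_left 𝕜 fun v => ?_
    simpa [ContinuousLinearMap.adjoint_inner_right] using h v w
  · simpa [ContinuousLinearMap.adjoint_inner_right] using
      congrArg (inner 𝕜 v) (DFunLike.congr_fun h w)

end OrthogonalFamily

section

variable {𝕜 I E F : Type*} [RCLike 𝕜] [NormedAddCommGroup E]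
  [InnerProductSpace 𝕜 E] [CompleteSpace E] [NormedAddCommGroup F]
  [InnerProductSpace 𝕜 F] [CompleteSpace F] {V : I → F →ₗᵢ[𝕜] E}

lemma isColumnContraction_adjoint (hV : OrthogonalFamily 𝕜 (fun _ => F) V) :
    IsColumnContraction fun i => (V i).toContinuousLinearMap.adjoint := by
  intro s v
  set w := ∑ i ∈ s, V i ((V i).toContinuousLinearMap.adjoint v) with hw
  have hnorm : ‖w‖ ^ 2 = ∑ i ∈ s, ‖(V i).toContinuousLinearMap.adjoint v‖ ^ 2 :=
    hV.norm_sum _ s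
  have hinner : RCLike.re (inner 𝕜 w v) = ‖w‖ ^ 2 := by
    rw [hnorm, hw, sum_inner, map_sum]
    refine Finset.sum_congr rfl fun i _ => ?_
    rw [← inner_self_eq_norm_sq (𝕜 := 𝕜), ContinuousLinearMap.adjoint_inner_right]
    rfl
  rw [← hnorm]
  have hle := re_inner_le_norm (𝕜 := 𝕜) w v
  nlinarith [norm_nonneg w, norm_nonneg v]

end

section HilbertTensor

variable {K K' : Type*} [NormedAddCommGroup K] [InnerProductSpace ℂ K] [NormedAddCommGroup K']
  [InnerProductSpace ℂ K']

namespace HilbertTensor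

lemma ext_tmul {F : Type*} [NormedAddCommGroup F] [NormedSpace ℂ F]
    {S T : HilbertTensor K →L[ℂ] F} (h : ∀ k v, S (incl K (k ⊗ₜ v)) = T (incl K (k ⊗ₜ v))) :
    S = T := by
  have hST : S.toLinearMap ∘ₗ (incl K).toLinearMap = T.toLinearMap ∘ₗ (incl K).toLinearMap :=
    TensorProduct.ext' h
  exact ContinuousLinearMap.coeFn_injective <|
    (denseRange_incl K).equalizer S.continuous T.continuous (congrArg DFunLike.coe hST)

lemma inner_incl_tmul (k k' : K) (v v' : ell2) :
    inner ℂ (incl K (k ⊗ₜ v)) (incl K (k' ⊗ₜ v')) = inner ℂ k k' * inner ℂ v v' := by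
  rw [LinearIsometry.inner_map_map, TensorProduct.inner_tmul]

lemma eq_of_inner_tmul {x y : HilbertTensor K}
    (h : ∀ k v, inner ℂ (incl K (k ⊗ₜ v)) x = inner ℂ (incl K (k ⊗ₜ v)) y) : x = y := by
  have hxy : innerSL ℂ x = innerSL ℂ y := ext_tmul fun k v => by
    simpa using congrArg (starRingEnd ℂ) (h k v)
  exact ext_inner_right ℂ fun z => DFunLike.congr_fun hxy z

lemma ext_inner_tmul {S T : HilbertTensor K →L[ℂ] HilbertTensor K'}
    (h : ∀ k v k' v', inner ℂ (incl K' (k' ⊗ₜ v')) (S (incl K (k ⊗ₜ v))) =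
      inner ℂ (incl K' (k' ⊗ₜ v')) (T (incl K (k ⊗ₜ v)))) : S = T :=
  ext_tmul fun k v => eq_of_inner_tmul (h k v)

end HilbertTensor

lemma opTensor_incl_tmul (c : K →L[ℂ] K) (b : ell2 →L[ℂ] ell2) (k : K) (v : ell2) :
    opTensor c b (HilbertTensor.incl K (k ⊗ₜ v)) = HilbertTensor.incl K (c k ⊗ₜ b v) :=
  opTensor_incl c b _

lemma opTensor_one_one : opTensor (1 : K →L[ℂ] K) 1 = 1 :=
  HilbertTensor.ext_tmul fun k v => opTensor_incl_tmul 1 1 k v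

lemma opTensor_comp (c c' : K →L[ℂ] K) (b b' : ell2 →L[ℂ] ell2) :
    opTensor (c ∘L c') (b ∘L b') = opTensor c b ∘L opTensor c' b' :=
  HilbertTensor.ext_tmul fun k v => by
    simp only [ContinuousLinearMap.comp_apply, opTensor_incl_tmul]

variable [CompleteSpace K]

lemma adjoint_opTensor (c : K →L[ℂ] K) (b : ell2 →L[ℂ] ell2) :
    (opTensor c b).adjoint = opTensor c.adjoint b.adjoint :=
  HilbertTensor.ext_inner_tmul fun k v k' v' => by
    simp only [ContinuousLinearMap.adjoint_inner_right, opTensor_incl_tmul,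
      HilbertTensor.inner_incl_tmul]

/-- The ampliation `b ↦ 1 ⊗ b` of `B(ℓ²)` to `K ⊗ ℓ²`. -/
def ampliation (K : Type*) [NormedAddCommGroup K] [InnerProductSpace ℂ K] [CompleteSpace K] :
    (ell2 →L[ℂ] ell2) →⋆ₐ[ℂ] (HilbertTensor K →L[ℂ] HilbertTensor K) :=
  { AlgHom.ofLinearMap (opTensorBilin (1 : K →L[ℂ] K)) opTensor_one_one (opTensor_comp 1 1) with
    map_star' := fun b => by
      refine Eq.trans ?_ (adjoint_opTensor 1 b).symm
      rw [← ContinuousLinearMap.star_eq_adjoint, star_one]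
      rfl }

lemma IsColumnContraction.map_ampliation {I : Type*} {B : I → ell2 →L[ℂ] ell2}
    (hB : IsColumnContraction B) : IsColumnContraction fun i => ampliation K (B i) := by
  rw [isColumnContraction_iff_sum_adjoint_comp_le_one] at hB ⊢
  intro s
  calc ∑ i ∈ s, star (ampliation K (B i)) * ampliation K (B i)
      = ampliation K (∑ i ∈ s, star (B i) * B i) := by
        simp only [map_sum, map_mul, map_star]
    _ ≤ ampliation K 1 := OrderHomClass.mono _ (hB s)
    _ = 1 := map_one _

end HilbertTensor

section DirectSum

variable {G : Type*} [DecidableEq G] {H : Type*} [NormedAddCommGroup H] [InnerProductSpace ℂ H]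

/-- The elementary vector `δ_t ξ ⊗ v` of `ℓ²(G,H) ⊗ ℓ²`. -/
def singleTmul (t : G) (ξ : H) (v : ell2) : HilbertTensor ℓ²(G,H) :=
  HilbertTensor.incl _ (lp.single 2 t ξ ⊗ₜ v)

lemma inner_singleTmul (s t : G) (ξ η : H) (v w : ell2) :
    inner ℂ (singleTmul s η w) (singleTmul t ξ v) =
      (if s = t then inner ℂ η ξ else 0) * inner ℂ w v := by
  rw [singleTmul, singleTmul, HilbertTensor.inner_incl_tmul, lp.inner_single_left, lp.single_apply,
    Pi.single_apply]
  split_ifs <;> simp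

lemma ext_singleTmul {F : Type*} [NormedAddCommGroup F] [NormedSpace ℂ F]
    {S T : HilbertTensor ℓ²(G,H) →L[ℂ] F}
    (h : ∀ t ξ v, S (singleTmul t ξ v) = T (singleTmul t ξ v)) : S = T := by
  refine HilbertTensor.ext_tmul fun k v => ?_
  let tmulRight : ℓ²(G,H) →L[ℂ] HilbertTensor ℓ²(G,H) :=
    (HilbertTensor.incl _).toContinuousLinearMap ∘L (TensorProduct.mkL ℂ ℓ²(G,H) ell2).flip v
  have hST : S ∘L tmulRight = T ∘L tmulRight := lp.ext_continuousLinearMap (by simp) fun t => by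
    ext ξ
    exact h t ξ v
  exact DFunLike.congr_fun hST k

lemma eq_of_inner_singleTmul {x y : HilbertTensor ℓ²(G,H)}
    (h : ∀ t ξ v, inner ℂ (singleTmul t ξ v) x = inner ℂ (singleTmul t ξ v) y) : x = y := by
  have hxy : innerSL ℂ x = innerSL ℂ y := ext_singleTmul fun t ξ v => by
    simpa using congrArg (starRingEnd ℂ) (h t ξ v)
  exact ext_inner_right ℂ fun z => DFunLike.congr_fun hxy z

lemma ext_inner_singleTmul {S T : HilbertTensor ℓ²(G,H) →L[ℂ] HilbertTensor ℓ²(G,H)}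
    (h : ∀ t ξ v s η w, inner ℂ (singleTmul s η w) (S (singleTmul t ξ v)) =
      inner ℂ (singleTmul s η w) (T (singleTmul t ξ v))) : S = T :=
  ext_singleTmul fun t ξ v => eq_of_inner_singleTmul (h t ξ v)

/-- The inclusion `ξ ⊗ v ↦ δ_t ξ ⊗ v` of `H ⊗ ℓ²` in `ℓ²(G,H) ⊗ ℓ²` as the summand at `t`. -/
def summandIncl (H : Type*) [NormedAddCommGroup H] [InnerProductSpace ℂ H] (t : G) :
    HilbertTensor H →ₗᵢ[ℂ] HilbertTensor ℓ²(G,H) :=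
  let single : H →ₗᵢ[ℂ] ℓ²(G,H) :=
    ⟨(lp.singleContinuousLinearMap ℂ (fun _ : G => H) 2 t).toLinearMap,
      fun ξ => lp.norm_single (E := fun _ : G => H) (p := 2) zero_lt_two t ξ⟩
  let ι : H ⊗[ℂ] ell2 →ₗᵢ[ℂ] ℓ²(G,H) ⊗[ℂ] ell2 :=
    TensorProduct.mapIsometry single LinearIsometry.id
  { toLinearMap := ι.toContinuousLinearMap.completion.toLinearMap
    norm_map' := ι.isometry.completion_map.norm_map_of_map_zero
      (map_zero ι.toContinuousLinearMap.completion) }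

lemma summandIncl_incl_tmul (t : G) (ξ : H) (v : ell2) :
    summandIncl H t (HilbertTensor.incl H (ξ ⊗ₜ v)) = singleTmul t ξ v :=
  ContinuousLinearMap.completion_apply_coe _ _

lemma orthogonalFamily_summandIncl :
    OrthogonalFamily ℂ (fun _ : G => HilbertTensor H) (summandIncl H) := by
  refine orthogonalFamily_iff_adjoint_comp_eq_zero.2 fun s t hst =>
    HilbertTensor.ext_inner_tmul fun k v k' v' => ?_
  rw [ContinuousLinearMap.comp_apply, ContinuousLinearMap.adjoint_inner_right]
  simp [summandIncl_incl_tmul, inner_singleTmul, hst]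

lemma isHilbertSum_summandIncl :
    IsHilbertSum ℂ (fun _ : G => HilbertTensor H) (summandIncl H) := by
  refine IsHilbertSum.mk orthogonalFamily_summandIncl (le_of_eq ?_)
  refine (Submodule.topologicalClosure_eq_top_iff.2 <|
    (Submodule.eq_bot_iff _).2 fun x hx => ?_).symm
  refine eq_of_inner_singleTmul fun t ξ v => ?_
  rw [inner_zero_right]
  exact hx _ (Submodule.mem_iSup_of_mem t ⟨_, summandIncl_incl_tmul t ξ v⟩)

variable [CompleteSpace H]

/-- The operator `δ_t ξ ⊗ v ↦ δ_t ξ ⊗ B_t v` on `ℓ²(G,H) ⊗ ℓ²`. -/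
def diagTensor (H : Type*) [NormedAddCommGroup H] [InnerProductSpace ℂ H] [CompleteSpace H]
    (B : G → ell2 →L[ℂ] ell2) (hB : ∀ t, ‖ampliation H (B t)‖ ≤ 1) :
    HilbertTensor ℓ²(G,H) →L[ℂ] HilbertTensor ℓ²(G,H) :=
  let U := (isHilbertSum_summandIncl (G := G) (H := H)).linearIsometryEquiv
  (U.symm : ℓ²(G,HilbertTensor H) →L[ℂ] _) ∘L
    lp.mapCLM 2 (fun t => ampliation H (B t)) zero_le_one hB ∘L
    (U : _ →L[ℂ] ℓ²(G,HilbertTensor H))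

lemma diagTensor_singleTmul (B : G → ell2 →L[ℂ] ell2)
    (hB : ∀ t, ‖ampliation H (B t)‖ ≤ 1) (t : G) (ξ : H) (v : ell2) :
    diagTensor H B hB (singleTmul t ξ v) = singleTmul t ξ (B t v) := by
  set U := (isHilbertSum_summandIncl (G := G) (H := H)).linearIsometryEquiv with hU
  have hsymm (v) : U.symm (lp.single 2 t (HilbertTensor.incl H (ξ ⊗ₜ v))) = singleTmul t ξ v := by
    rw [hU, IsHilbertSum.linearIsometryEquiv_symm_apply_single, summandIncl_incl_tmul]
  change U.symm (lp.mapCLM 2 _ zero_le_one hB (U (singleTmul t ξ v))) = _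
  rw [← hsymm v, LinearIsometryEquiv.apply_symm_apply, ← hsymm (B t v)]
  congr 1
  ext s
  rw [lp.mapCLM_apply_coe]
  rcases eq_or_ne s t with rfl | hs
  · rw [lp.single_apply_self, lp.single_apply_self]
    exact opTensor_incl_tmul 1 (B s) ξ v
  · simp [hs]

lemma IsColumnContraction.diagTensor {I : Type*} {B : G → I → ell2 →L[ℂ] ell2}
    (hB : ∀ t, IsColumnContraction (B t)) :
    IsColumnContraction fun i =>
      diagTensor H (fun t => B t i) fun t => (hB t).map_ampliation.norm_le i :=
  (isColumnContraction_mapCLM fun t => (hB t).map_ampliation).conj_linearIsometryEquiv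
    isHilbertSum_summandIncl.linearIsometryEquiv isHilbertSum_summandIncl.linearIsometryEquiv.symm

end DirectSum

section Shift

lemma orthonormal_basisVec : Orthonormal ℂ basisVec := by
  rw [orthonormal_iff_ite]
  intro i j
  rw [inner_basisVec, basisVec, lp.single_apply, Pi.single_apply]

lemma exists_orthogonalFamily_ell2 (I : Type*) [Countable I] :
    ∃ W : I → ell2 →ₗᵢ[ℂ] ell2, OrthogonalFamily ℂ (fun _ : I => ell2) W := by
  obtain ⟨e, he⟩ := exists_injective_nat (I × ℕ)
  have hcol (i : I) : Orthonormal ℂ fun n => basisVec (e (i, n)) :=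
    orthonormal_basisVec.comp _ fun m n h => (Prod.ext_iff.1 (he h)).2
  let W (i : I) : ell2 →ₗᵢ[ℂ] ell2 := (hcol i).orthogonalFamily.linearIsometry
  have hW (i : I) (n : ℕ) (z : ℂ) : W i (lp.single 2 n z) = z • basisVec (e (i, n)) :=
    (hcol i).orthogonalFamily.linearIsometry_apply_single z
  refine ⟨W, orthogonalFamily_iff_adjoint_comp_eq_zero.2 fun i j hij =>
    lp.ext_continuousLinearMap (by simp) fun n => ContinuousLinearMap.ext fun z =>
      lp.ext <| funext fun m => ?_⟩
  have hne : e (i, m) ≠ e (j, n) := fun h => hij (Prod.ext_iff.1 (he h)).1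
  simp only [ContinuousLinearMap.comp_apply, lp.singleContinuousLinearMap_apply]
  rw [← inner_basisVec, ContinuousLinearMap.adjoint_inner_right]
  simp only [LinearIsometry.coe_toContinuousLinearMap, basisVec, hW, one_smul, inner_smul_right]
  rw [← basisVec, ← basisVec, orthonormal_basisVec.2 hne]
  simp

variable {Γ : Type*} [Group Γ] {W : Γ → ell2 →ₗᵢ[ℂ] ell2}
  (hW : OrthogonalFamily ℂ (fun _ : Γ => ell2) W)

/-- The operator `∑ₛ W_{gs} b Wₛ*`, a copy of `λ_g ⊗ b` on `ℓ²(Γ) ⊗ ℓ²`. -/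
def shift (g : Γ) (b : ell2 →L[ℂ] ell2) : ell2 →L[ℂ] ell2 :=
  ((isColumnContraction_adjoint hW).comp_injective (mul_right_injective g)).sandwich
    (isColumnContraction_adjoint hW) b

lemma inner_shift (g : Γ) (b : ell2 →L[ℂ] ell2) (v w : ell2) :
    inner ℂ w (shift hW g b v) =
      ∑' s, inner ℂ ((W (g * s)).toContinuousLinearMap.adjoint w)
        (b ((W s).toContinuousLinearMap.adjoint v)) :=
  IsColumnContraction.inner_sandwich _ _ b v w

lemma shift_apply (g s : Γ) (b : ell2 →L[ℂ] ell2) (v : ell2) :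
    shift hW g b (W s v) = W (g * s) (b v) := by
  refine ext_inner_left ℂ fun w => ?_
  have hs : (W s).toContinuousLinearMap.adjoint (W s v) = v :=
    DFunLike.congr_fun (LinearIsometry.adjoint_comp_self (W s)) v
  have ht {t : Γ} (hts : t ≠ s) : (W t).toContinuousLinearMap.adjoint (W s v) = 0 :=
    DFunLike.congr_fun (orthogonalFamily_iff_adjoint_comp_eq_zero.1 hW hts) v
  rw [inner_shift, tsum_eq_single s fun t hts => by rw [ht hts, map_zero, inner_zero_right], hs,
    ContinuousLinearMap.adjoint_inner_left]
  rfl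

end Shift

section Subgroup

variable {G : Type*} [Group G]

lemma exists_equivariant_retraction (Γ : Subgroup G) :
    ∃ q : G → Γ, ∀ (g : Γ) (t : G), q (g * t) = g * q t := by
  obtain ⟨T, hT, -⟩ := Γ.exists_isComplement_right 1
  exact ⟨fun t => (hT.equiv t).1, fun g t => congrArg Prod.fst (hT.equiv_mul_left g t)⟩

lemma countable_closure {s : Set G} (hs : s.Countable) : Countable (Subgroup.closure s) := by
  have : Countable s := hs.to_subtype
  rw [FreeGroup.closure_eq_range]
  exact (FreeGroup.lift ((↑) : s → G)).rangeRestrict_surjective.countable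

end Subgroup

section Fibers

variable {G : Type*} [Group G] {H : Type*} [NormedAddCommGroup H]
  [InnerProductSpace ℂ H] [CompleteSpace H] {A : StarSubalgebra ℂ (H →L[ℂ] H)}
  [IsClosed (A : Set (H →L[ℂ] H))] (α : G →* (A ≃⋆ₐ[ℂ] A))

lemma piRep_mul_lam_single [DecidableEq G] (a : A) (g t : G) (ξ : H) :
    (piRep α a * lam H g) (lp.single 2 t ξ) =
      lp.single 2 (g * t) (((α (g * t)⁻¹ a : A) : H →L[ℂ] H) ξ) := by
  ext s
  change ((α s⁻¹ a : A) : H →L[ℂ] H) ((lp.single 2 t ξ : ℓ²(G,H)) (g⁻¹ * s)) = _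
  rcases eq_or_ne s (g * t) with rfl | hs
  · simp
  · have h : g⁻¹ * s ≠ t := fun h => hs (by rw [← h, mul_inv_cancel_left])
    simp [hs, h]

lemma mem_reducedCrossedProduct_iff (x : ℓ²(G,H) →L[ℂ] ℓ²(G,H)) :
    x ∈ reducedCrossedProduct α ↔
      x ∈ (Submodule.span ℂ
        {x | ∃ (a : A) (r : G), x = piRep α a * lam H r}).topologicalClosure := by
  change x ∈ closure (integratedForm α '' l1 G A) ↔ _
  rw [closure_image_integratedForm, StarSubalgebra.topologicalClosure_coe]
  rfl

lemma piRep_mul_lam_mem (a : A) (g : G) : piRep α a * lam H g ∈ reducedCrossedProduct α :=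
  (mem_reducedCrossedProduct_iff α _).2 (subset_closure (Submodule.subset_span ⟨a, g, rfl⟩))

/-- The map `a ↦ π(a) λ_g` from `A` to `A ⋊ G`. -/
def fiberIncl (g : G) : A →L[ℂ] reducedCrossedProduct α :=
  LinearMap.mkContinuous
    { toFun := fun a => ⟨piRep α a * lam H g, piRep_mul_lam_mem α a g⟩
      map_add' := fun a b =>
        Subtype.ext ((congrArg (· * lam H g) (piRep_add α a b)).trans (add_mul _ _ _))
      map_smul' := fun z a =>
        Subtype.ext ((congrArg (· * lam H g) (piRep_smul α z a)).trans (smul_mul_assoc _ _ _)) }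
    1 fun a =>
    calc ‖piRep α a * lam H g‖ ≤ ‖piRep α a‖ * ‖lam H g‖ := norm_mul_le _ _
      _ ≤ ‖a‖ * 1 := by
        gcongr
        exacts [norm_piRep_le α a, norm_lam_le g]
      _ = 1 * ‖a‖ := mul_comm _ _

lemma coe_fiberIncl (g : G) (a : A) :
    (fiberIncl α g a : ℓ²(G,H) →L[ℂ] ℓ²(G,H)) = piRep α a * lam H g := rfl

/-- The span of the elements `π(a) λ_g` in `A ⋊ G`. -/
def fiberSpan : Submodule ℂ (reducedCrossedProduct α) :=
  Submodule.span ℂ {x | ∃ g a, x = fiberIncl α g a}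

lemma dense_fiberSpan : Dense (fiberSpan α : Set (reducedCrossedProduct α)) := by
  have hle : Submodule.span ℂ {x | ∃ (a : A) (r : G), x = piRep α a * lam H r} ≤
      (fiberSpan α).map (reducedCrossedProduct α).toSubalgebra.val.toLinearMap := by
    refine Submodule.span_le.2 ?_
    rintro _ ⟨a, g, rfl⟩
    exact ⟨fiberIncl α g a, Submodule.subset_span ⟨g, a, rfl⟩, rfl⟩
  exact Subtype.dense_iff.2 fun x hx => closure_mono hle ((mem_reducedCrossedProduct_iff α x).1 hx)

lemma ext_fiberIncl {F : Type*} [NormedAddCommGroup F] [NormedSpace ℂ F]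
    {S T : reducedCrossedProduct α →L[ℂ] F}
    (h : ∀ g a, S (fiberIncl α g a) = T (fiberIncl α g a)) : S = T :=
  ContinuousLinearMap.ext_on (dense_fiberSpan α) (by rintro _ ⟨g, a, rfl⟩; exact h g a)

variable [DecidableEq G]

/-- The `(1, g⁻¹)` entry of an operator on `ℓ²(G,H)`. -/
def entry (H : Type*) [NormedAddCommGroup H] [InnerProductSpace ℂ H] (g : G) :
    (ℓ²(G,H) →L[ℂ] ℓ²(G,H)) →L[ℂ] (H →L[ℂ] H) :=
  (lp.evalCLM ℂ (fun _ : G => H) 2 1).postcomp H ∘L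
    (lp.singleContinuousLinearMap ℂ (fun _ : G => H) 2 g⁻¹).precomp ℓ²(G,H)

lemma entry_piRep_mul_lam (g h : G) (a : A) :
    entry H g (piRep α a * lam H h) = if h = g then (a : H →L[ℂ] H) else 0 := by
  ext ξ
  change (piRep α a * lam H h) (lp.single 2 g⁻¹ ξ) 1 = _
  rw [piRep_mul_lam_single]
  split_ifs with hg
  · subst hg; simp
  · have : (1 : G) ≠ h * g⁻¹ := fun h1 => hg (mul_inv_eq_one.1 h1.symm)
    simp [this]

lemma entry_mem (g : G) (x : reducedCrossedProduct α) :
    entry H g (x : ℓ²(G,H) →L[ℂ] ℓ²(G,H)) ∈ A := by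
  have hA : IsClosed (A : Set (H →L[ℂ] H)) := inferInstance
  refine Submodule.topologicalClosure_minimal _
    (t := A.toSubalgebra.toSubmodule.comap (entry H g).toLinearMap) (Submodule.span_le.2 ?_)
    (hA.preimage (entry H g).continuous) ((mem_reducedCrossedProduct_iff α x).1 x.2)
  rintro _ ⟨a, h, rfl⟩
  change entry H g (piRep α a * lam H h) ∈ A
  rw [entry_piRep_mul_lam]
  split_ifs
  exacts [a.2, zero_mem A]

/-- The Fourier coefficient `A ⋊ G → A` at `g`. -/
def coeff (g : G) : reducedCrossedProduct α →L[ℂ] A :=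
  (entry H g ∘L (reducedCrossedProduct α).toSubalgebra.toSubmodule.subtypeL).codRestrict
    A.toSubalgebra.toSubmodule (entry_mem α g)

lemma coe_coeff (g : G) (x : reducedCrossedProduct α) :
    (coeff α g x : H →L[ℂ] H) = entry H g (x : ℓ²(G,H) →L[ℂ] ℓ²(G,H)) := rfl

lemma coeff_fiberIncl (g h : G) (a : A) :
    coeff α g (fiberIncl α h a) = if h = g then a else 0 := by
  refine Subtype.ext ?_
  rw [coe_coeff, coe_fiberIncl, entry_piRep_mul_lam]
  split_ifs <;> rfl

lemma coeff_integratedForm {f : G → A} (hf : f ∈ l1 G A) (g : G) :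
    coeff α g ⟨integratedForm α f, integratedForm_mem α hf⟩ = f g := by
  refine Subtype.ext ?_
  have h : HasSum (fun s => if s = g then (f s : H →L[ℂ] H) else 0)
      (entry H g (integratedForm α f)) := by
    simpa only [entry_piRep_mul_lam] using!
      (entry H g).hasSum (summable_integratedForm α hf).hasSum
  rw [coe_coeff, ← h.tsum_eq, tsum_ite_eq]

lemma finite_support_coeff {x : reducedCrossedProduct α} (hx : x ∈ fiberSpan α) :
    {g | coeff α g x ≠ 0}.Finite := by
  refine Submodule.span_induction ?_ ?_ ?_ ?_ hx
  · rintro _ ⟨h, a, rfl⟩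
    refine (Set.finite_singleton h).subset fun g hg => ?_
    by_contra hne
    exact hg (by rw [coeff_fiberIncl, if_neg fun h' => hne h'.symm])
  · simp
  · intro x y _ _ hx hy
    refine (hx.union hy).subset fun g hg => ?_
    by_contra h
    obtain ⟨hgx, hgy⟩ := not_or.1 h
    exact hg (by rw [map_add, not_not.1 hgx, not_not.1 hgy, add_zero])
  · exact fun z x _ hx => hx.subset fun g hg h => hg (by rw [map_smul, h, smul_zero])

end Fibers

section ClosedSpan

variable {𝕜 E B B' : Type*} [NontriviallyNormedField 𝕜] [NormedAddCommGroup E] [NormedSpace 𝕜 E]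
  [NormedAddCommGroup B] [NormedSpace 𝕜 B] [NormedAddCommGroup B'] [NormedSpace 𝕜 B']

lemma exists_countable_mem_closure_span_image {I : Type*} {f : I → E} {x : E}
    (hx : x ∈ (Submodule.span 𝕜 (Set.range f)).topologicalClosure) :
    ∃ t : Set I, t.Countable ∧ x ∈ (Submodule.span 𝕜 (f '' t)).topologicalClosure := by
  obtain ⟨y, hy, hyx⟩ := mem_closure_iff_seq_limit.1 hx
  choose c hc using fun n => Finsupp.mem_span_range_iff_exists_finsupp.1 (hy n)
  refine ⟨⋃ n, ((c n).support : Set I), Set.countable_iUnion fun n => (c n).support.countable_toSet,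
    mem_closure_of_tendsto hyx <| .of_forall fun n => ?_⟩
  rw [← hc n]
  exact Submodule.sum_mem _ fun i hi => Submodule.smul_mem _ _ <|
    Submodule.subset_span ⟨i, Set.mem_iUnion_of_mem n hi, rfl⟩

lemma exists_mem_apply_eq_of_mem_closure_span {f : E →L[𝕜] B} {M : Submodule 𝕜 B}
    (hM : IsClosed (M : Set B)) {P : M →L[𝕜] B'} {Q : E →L[𝕜] B'} {s : Set E}
    (hs : ∀ x ∈ s, ∃ h : f x ∈ M, P ⟨f x, h⟩ = Q x) {x : E}
    (hx : x ∈ (Submodule.span 𝕜 s).topologicalClosure) : ∃ h : f x ∈ M, P ⟨f x, h⟩ = Q x := by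
  let N : Submodule 𝕜 E := M.comap f.toLinearMap
  let g : N →L[𝕜] M := (f ∘L N.subtypeL).codRestrict M fun x => x.2
  let L : Submodule 𝕜 N := LinearMap.eqLocus (P ∘L g).toLinearMap (Q ∘L N.subtypeL).toLinearMap
  have hL : IsClosed (L : Set N) := isClosed_eq (P ∘L g).continuous (Q ∘L N.subtypeL).continuous
  have hclosed : IsClosed (L.map N.subtype : Set E) :=
    (hM.preimage f.continuous).isClosedEmbedding_subtypeVal.isClosedMap _ hL
  have hsL : s ⊆ L.map N.subtype := fun x hxs =>
    let ⟨h, hPQ⟩ := hs x hxs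
    ⟨⟨x, h⟩, hPQ, rfl⟩
  obtain ⟨y, hy, rfl⟩ :=
    Submodule.topologicalClosure_minimal _ (Submodule.span_le.2 hsL) hclosed hx
  exact ⟨y.2, hy⟩

end ClosedSpan

section TensorContinuity

variable {K : Type*} [NormedAddCommGroup K] [InnerProductSpace ℂ K] [CompleteSpace K]

/-- The slice `c ↦ c ⊗ b` as a bounded map. -/
def opTensorRight (K : Type*) [NormedAddCommGroup K] [InnerProductSpace ℂ K] [CompleteSpace K]
    (b : ell2 →L[ℂ] ell2) :
    (K →L[ℂ] K) →L[ℂ] (HilbertTensor K →L[ℂ] HilbertTensor K) :=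
  LinearMap.mkContinuous (opTensorBilin.flip b) ‖b‖ fun c =>
    (norm_opTensor_le c b).trans_eq (mul_comm _ _)

lemma continuous_toMinTensor_tmul (C : StarSubalgebra ℂ (K →L[ℂ] K)) (b : ell2 →L[ℂ] ell2) :
    Continuous fun c : C => toMinTensor C (c ⊗ₜ b) :=
  Continuous.subtype_mk ((opTensorRight K b).continuous.comp continuous_subtype_val) _

variable {C : StarSubalgebra ℂ (K →L[ℂ] K)}

lemma ext_toMinTensor_tmul {F : Type*} [NormedAddCommGroup F] [NormedSpace ℂ F]
    {S T : minTensor C →L[ℂ] F}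
    (h : ∀ c b, S (toMinTensor C (c ⊗ₜ b)) = T (toMinTensor C (c ⊗ₜ b))) : S = T := by
  have hST : S.toLinearMap ∘ₗ toMinTensor C = T.toLinearMap ∘ₗ toMinTensor C :=
    TensorProduct.ext' h
  exact ContinuousLinearMap.coeFn_injective <|
    (denseRange_toMinTensor C).equalizer S.continuous T.continuous (congrArg DFunLike.coe hST)

lemma amplify_toMinTensor_tmul {T : C →L[ℂ] C} (hT : T ∈ CBMap C) (c : C) (b : ell2 →L[ℂ] ell2) :
    amplify T (toMinTensor C (c ⊗ₜ b)) = toMinTensor C (T c ⊗ₜ b) :=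
  amplify_toMinTensor ⟨T, hT⟩ _

lemma amplify_id : amplify (CBMap.id C : C →L[ℂ] C) = ContinuousLinearMap.id ℂ _ :=
  ext_toMinTensor_tmul (amplify_toMinTensor_tmul (CBMap.id C).2)

lemma topologicalClosure_span_tmul_eq_top {I : Type*} {f : I → C}
    (hf : Dense (Submodule.span ℂ (Set.range f) : Set C)) :
    (Submodule.span ℂ (Set.range fun p : I × (ell2 →L[ℂ] ell2) =>
      toMinTensor C (f p.1 ⊗ₜ p.2))).topologicalClosure = ⊤ := by
  set D := (Submodule.span ℂ (Set.range fun p : I × (ell2 →L[ℂ] ell2) =>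
    toMinTensor C (f p.1 ⊗ₜ p.2))).topologicalClosure
  have hDc : IsClosed (D : Set (minTensor C)) := Submodule.isClosed_topologicalClosure _
  have htmul (c : C) (b : ell2 →L[ℂ] ell2) : toMinTensor C (c ⊗ₜ b) ∈ D := by
    have hspan : Submodule.span ℂ (Set.range f) ≤
        D.comap (toMinTensor C ∘ₗ (TensorProduct.mk ℂ C _).flip b) := by
      refine Submodule.span_le.2 ?_
      rintro _ ⟨i, rfl⟩
      exact Submodule.le_topologicalClosure _ (Submodule.subset_span ⟨(i, b), rfl⟩)
    exact closure_minimal hspan (hDc.preimage (continuous_toMinTensor_tmul C b)) (hf c)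
  have hrange (u : C ⊗[ℂ] (ell2 →L[ℂ] ell2)) : toMinTensor C u ∈ D := by
    induction u with
    | zero => exact map_zero (toMinTensor C) ▸ D.zero_mem
    | add u v hu hv => exact map_add (toMinTensor C) u v ▸ D.add_mem hu hv
    | tmul c b => exact htmul c b
  exact Submodule.eq_top_iff'.2 fun x =>
    closure_minimal (Set.range_subset_iff.2 hrange) hDc (denseRange_toMinTensor C x)

lemma exists_mem_amplify_eq
    {Θ Ψ : (HilbertTensor K →L[ℂ] HilbertTensor K) →L[ℂ] (HilbertTensor K →L[ℂ] HilbertTensor K)}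
    {Φ S : C →L[ℂ] C} (hΦ : Φ ∈ CBMap C) (hS : S ∈ CBMap C) {s : Set (minTensor C)}
    (hs : ∀ x ∈ s, ∃ (c : C) (b b' : ell2 →L[ℂ] ell2), x = toMinTensor C (c ⊗ₜ b) ∧
      Θ (opTensor (c : K →L[ℂ] K) b) = opTensor (c : K →L[ℂ] K) b' ∧
      Ψ (opTensor (Φ c : K →L[ℂ] K) b') = opTensor (S c : K →L[ℂ] K) b)
    {x : minTensor C} (hx : x ∈ (Submodule.span ℂ s).topologicalClosure) :
    ∃ h : Θ x ∈ minTensor C, Ψ (amplify Φ ⟨Θ x, h⟩) = amplify S x := by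
  let ι := (minTensor C).subtypeL
  refine exists_mem_apply_eq_of_mem_closure_span (f := Θ ∘L ι) (P := Ψ ∘L ι ∘L amplify Φ)
    (Q := ι ∘L amplify S) (Submodule.isClosed_topologicalClosure _) (fun y hy => ?_) hx
  obtain ⟨c, b, b', rfl, hΘ, hΨ⟩ := hs y hy
  have hmem : (⟨Θ (opTensor (c : K →L[ℂ] K) b), hΘ ▸ (toMinTensor C (c ⊗ₜ b')).2⟩ : minTensor C) =
      toMinTensor C (c ⊗ₜ b') := Subtype.ext hΘ
  refine ⟨_, (congrArg (fun z => Ψ (amplify Φ z : minTensor C)) hmem).trans ?_⟩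
  rw [amplify_toMinTensor_tmul hΦ]
  exact hΨ.trans (congrArg Subtype.val (amplify_toMinTensor_tmul hS c b)).symm

lemma dist_amplify_le_of_apply_eq
    {Ψ : (HilbertTensor K →L[ℂ] HilbertTensor K) →L[ℂ] (HilbertTensor K →L[ℂ] HilbertTensor K)}
    (hΨ : ‖Ψ‖ ≤ 1) {Φ S : C →L[ℂ] C} {x z : minTensor C} (hS : Ψ (amplify Φ z) = amplify S x)
    (hz : Ψ z = x) : dist (amplify S x) x ≤ dist (amplify Φ z) z :=
  calc dist (amplify S x) x = dist (Ψ (amplify Φ z)) (Ψ z) := by rw [hS, hz]; rfl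
    _ ≤ ‖Ψ‖ * dist (amplify Φ z) z := Ψ.dist_le_opNorm _ _
    _ ≤ dist (amplify Φ z) z := mul_le_of_le_one_left dist_nonneg hΨ

lemma exists_forall_dist_amplify_le_of_rel
    {Θ Ψ : (HilbertTensor K →L[ℂ] HilbertTensor K) →L[ℂ] (HilbertTensor K →L[ℂ] HilbertTensor K)}
    (hΨ : ‖Ψ‖ ≤ 1) {R : (C →L[ℂ] C) → (C →L[ℂ] C) → Prop} (hid : R (CBMap.id C) (CBMap.id C))
    {s : Set (minTensor C)}
    (hs : ∀ x ∈ s, ∃ (c : C) (b b' : ell2 →L[ℂ] ell2), x = toMinTensor C (c ⊗ₜ b) ∧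
      Θ (opTensor (c : K →L[ℂ] K) b) = opTensor (c : K →L[ℂ] K) b' ∧
      ∀ Φ S, R Φ S → Ψ (opTensor (Φ c : K →L[ℂ] K) b') = opTensor (S c : K →L[ℂ] K) b)
    {x : minTensor C} (hx : x ∈ (Submodule.span ℂ s).topologicalClosure) :
    ∃ z, ∀ Φ ∈ CBMap C, ∀ S ∈ CBMap C, R Φ S → dist (amplify S x) x ≤ dist (amplify Φ z) z := by
  have hlift : ∀ Φ ∈ CBMap C, ∀ S ∈ CBMap C, R Φ S →
      ∃ h : Θ x ∈ minTensor C, Ψ (amplify Φ ⟨Θ x, h⟩) = amplify S x := by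
    refine fun Φ hΦ S hS hR => exists_mem_amplify_eq hΦ hS (fun y hy => ?_) hx
    obtain ⟨c, b, b', hy, hΘ, hΨ⟩ := hs y hy
    exact ⟨c, b, b', hy, hΘ, hΨ Φ S hR⟩
  obtain ⟨hmem, hid⟩ := hlift _ (CBMap.id C).2 _ (CBMap.id C).2 hid
  rw [amplify_id] at hid
  refine ⟨⟨Θ x, hmem⟩, fun Φ hΦ S hS hR => ?_⟩
  obtain ⟨_, hΦS⟩ := hlift Φ hΦ S hS hR
  exact dist_amplify_le_of_apply_eq hΨ hΦS hid

end TensorContinuity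

lemma isColumnContraction_single {𝕜 I E F : Type*} [DecidableEq I] [RCLike 𝕜] [NormedAddCommGroup E]
    [InnerProductSpace 𝕜 E] [NormedAddCommGroup F] [InnerProductSpace 𝕜 F] (p : I)
    {T : E →L[𝕜] F} (hT : ‖T‖ ≤ 1) :
    IsColumnContraction (Pi.single p T : I → E →L[𝕜] F) := fun s v => by
  have hTv : ‖T v‖ ^ 2 ≤ ‖v‖ ^ 2 := by
    gcongr
    simpa using T.le_of_opNorm_le hT v
  have hsum (j : I) :
      ‖(Pi.single p T : I → E →L[𝕜] F) j v‖ ^ 2 = if j = p then ‖T v‖ ^ 2 else 0 := by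
    rcases eq_or_ne j p with rfl | hj <;> simp [*]
  simp only [hsum, Finset.sum_ite_eq']
  split_ifs
  exacts [hTv, sq_nonneg _]

lemma eq_mul_iff_of_equivariant {G : Type*} [Group G] {Γ : Subgroup G} {q : G → Γ}
    (hq : ∀ (g : Γ) (t : G), q (g * t) = g * q t) (g : Γ)
    (s t : G) :
    s = g * t ↔ (q s : G)⁻¹ * s = (q t : G)⁻¹ * t ∧ q s = g * q t := by
  constructor
  · rintro rfl
    rw [hq, Subgroup.coe_mul]
    exact ⟨by group, rfl⟩
  · rintro ⟨hp, hqs⟩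
    rw [hqs, Subgroup.coe_mul, inv_mul_eq_iff_eq_mul] at hp
    rw [hp]
    group

section Absorption

variable {G : Type*} [Group G] {H : Type*} [NormedAddCommGroup H]
  [InnerProductSpace ℂ H] [CompleteSpace H] {A : StarSubalgebra ℂ (H →L[ℂ] H)}
  [IsClosed (A : Set (H →L[ℂ] H))] (α : G →* (A ≃⋆ₐ[ℂ] A))

lemma exists_countable_subgroup_mem_closure (x : minTensor (reducedCrossedProduct α)) :
    ∃ Γ : Subgroup G, Countable Γ ∧ x ∈ (Submodule.span ℂ
      {x | ∃ (g : Γ) (a : A) (b : ell2 →L[ℂ] ell2),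
        x = toMinTensor _ (fiberIncl α (g : G) a ⊗ₜ b)}).topologicalClosure := by
  have hdense : Dense (Submodule.span ℂ (Set.range fun p : G × A => fiberIncl α p.1 p.2) :
      Set (reducedCrossedProduct α)) :=
    (dense_fiberSpan α).mono <| Submodule.span_mono <| by
      rintro _ ⟨g, a, rfl⟩
      exact ⟨(g, a), rfl⟩
  obtain ⟨t, ht, hxt⟩ := exists_countable_mem_closure_span_image
    (topologicalClosure_span_tmul_eq_top hdense ▸ Submodule.mem_top (x := x))
  refine ⟨Subgroup.closure ((fun p => p.1.1) '' t), countable_closure (ht.image _),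
    Submodule.topologicalClosure_mono (Submodule.span_mono ?_) hxt⟩
  rintro _ ⟨p, hp, rfl⟩
  exact ⟨⟨p.1.1, Subgroup.subset_closure ⟨p, hp, rfl⟩⟩, p.1.2, p.2, rfl⟩

variable [DecidableEq G]

lemma inner_opTensor_fiberIncl (g s t : G) (a : A) (b : ell2 →L[ℂ] ell2) (ξ η : H) (v w : ell2) :
    inner ℂ (singleTmul s η w)
        (opTensor (fiberIncl α g a : ℓ²(G,H) →L[ℂ] ℓ²(G,H)) b (singleTmul t ξ v)) =
      (if s = g * t then inner ℂ η (((α (g * t)⁻¹ a : A) : H →L[ℂ] H) ξ) else 0) *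
        inner ℂ w (b v) := by
  rw [singleTmul.eq_def t, opTensor_incl_tmul, coe_fiberIncl, piRep_mul_lam_single, ← singleTmul,
    inner_singleTmul]

variable {Γ : Subgroup G} {W : Γ → ell2 →ₗᵢ[ℂ] ell2}
  (hW : OrthogonalFamily ℂ (fun _ : Γ => ell2) W) (q : G → Γ)

/-- The map `π(a) λ_g ⊗ b ↦ π(a) λ_g ⊗ (λ_g ⊗ b)` for `g ∈ Γ`, extended to all operators, where
`B(ℓ²(Γ) ⊗ ℓ²)` is identified with `B(ℓ²)` through `W`. -/
def absorb (H : Type*) [NormedAddCommGroup H] [InnerProductSpace ℂ H] [CompleteSpace H] :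
    (HilbertTensor ℓ²(G,H) →L[ℂ] HilbertTensor ℓ²(G,H)) →L[ℂ]
      (HilbertTensor ℓ²(G,H) →L[ℂ] HilbertTensor ℓ²(G,H)) :=
  have hcol (t : G) := (isColumnContraction_adjoint hW).comp_injective (mul_right_injective (q t))
  (IsColumnContraction.diagTensor hcol).sandwich (IsColumnContraction.diagTensor hcol)

lemma isColumnContraction_single_transversal (W : Γ → ell2 →ₗᵢ[ℂ] ell2) (q : G → Γ) (t : G) :
    IsColumnContraction (Pi.single ((q t : G)⁻¹ * t) (W (q t)).toContinuousLinearMap :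
      G → ell2 →L[ℂ] ell2) :=
  isColumnContraction_single _ (W (q t)).norm_toContinuousLinearMap_le

/-- A left inverse of `absorb` that sends `π(a) λ_h ⊗ (λ_g ⊗ b)` to `0` for `h ≠ g`. -/
def unabsorb (W : Γ → ell2 →ₗᵢ[ℂ] ell2) (q : G → Γ) (H : Type*) [NormedAddCommGroup H]
    [InnerProductSpace ℂ H] [CompleteSpace H] :
    (HilbertTensor ℓ²(G,H) →L[ℂ] HilbertTensor ℓ²(G,H)) →L[ℂ]
      (HilbertTensor ℓ²(G,H) →L[ℂ] HilbertTensor ℓ²(G,H)) :=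
  have hcol := isColumnContraction_single_transversal W q
  (IsColumnContraction.diagTensor hcol).sandwich (IsColumnContraction.diagTensor hcol)

variable {q}

lemma absorb_opTensor_fiberIncl (hq : ∀ (g : Γ) (t : G), q (g * t) = g * q t) (g : Γ) (a : A)
    (b : ell2 →L[ℂ] ell2) :
    absorb hW q H (opTensor (fiberIncl α (g : G) a : ℓ²(G,H) →L[ℂ] ℓ²(G,H)) b) =
      opTensor (fiberIncl α (g : G) a : ℓ²(G,H) →L[ℂ] ℓ²(G,H)) (shift hW g b) := by
  refine ext_inner_singleTmul fun t ξ v s η w => ?_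
  rw [absorb, IsColumnContraction.inner_sandwich]
  simp only [diagTensor_singleTmul, inner_opTensor_fiberIncl]
  rw [tsum_mul_left]
  split_ifs with hs
  · rw [inner_shift, hs, hq, ← (Equiv.mulLeft (q t)).tsum_eq fun r : Γ =>
      inner ℂ ((W (g * r)).toContinuousLinearMap.adjoint w)
        (b ((W r).toContinuousLinearMap.adjoint v))]
    simp only [Equiv.coe_mulLeft, mul_assoc]
  · rw [zero_mul, zero_mul]

lemma tsum_inner_single_shift (hq : ∀ (g : Γ) (t : G), q (g * t) = g * q t) (g : Γ) (s t : G)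
    (b : ell2 →L[ℂ] ell2) (v w : ell2) :
    ∑' j : G, inner ℂ
        ((Pi.single ((q s : G)⁻¹ * s) (W (q s)).toContinuousLinearMap : G → ell2 →L[ℂ] ell2) j w)
        (shift hW g b ((Pi.single ((q t : G)⁻¹ * t) (W (q t)).toContinuousLinearMap :
          G → ell2 →L[ℂ] ell2) j v)) =
      if s = g * t then inner ℂ w (b v) else 0 := by
  rw [tsum_eq_single ((q t : G)⁻¹ * t) fun j hj => by simp [hj], Pi.single_eq_same,
    LinearIsometry.coe_toContinuousLinearMap, shift_apply, Pi.single_apply]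
  simp only [eq_mul_iff_of_equivariant hq, eq_comm (a := (q t : G)⁻¹ * t), ite_and]
  split_ifs with hp hqs
  · rw [LinearIsometry.coe_toContinuousLinearMap, hqs, LinearIsometry.inner_map_map]
  · exact hW hqs w (b v)
  · simp

lemma unabsorb_opTensor_fiberIncl (hq : ∀ (g : Γ) (t : G), q (g * t) = g * q t) (g : Γ) (h : G)
    (a : A) (b : ell2 →L[ℂ] ell2) :
    unabsorb W q H (opTensor (fiberIncl α h a : ℓ²(G,H) →L[ℂ] ℓ²(G,H)) (shift hW g b)) =
      opTensor (fiberIncl α (g : G) (coeff α g (fiberIncl α h a)) : ℓ²(G,H) →L[ℂ] ℓ²(G,H)) b := by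
  refine ext_inner_singleTmul fun t ξ v s η w => ?_
  rw [unabsorb, IsColumnContraction.inner_sandwich]
  simp only [diagTensor_singleTmul, inner_opTensor_fiberIncl]
  rw [tsum_mul_left, tsum_inner_single_shift hW hq, coeff_fiberIncl]
  rcases eq_or_ne h g with rfl | hg
  · rw [if_pos rfl]
    split_ifs <;> simp only [zero_mul, mul_zero]
  · rw [if_neg hg]
    split_ifs with hs hs'
    · exact absurd (mul_right_cancel (hs.symm.trans hs')) hg
    all_goals simp

lemma unabsorb_opTensor (hq : ∀ (g : Γ) (t : G), q (g * t) = g * q t) (g : Γ)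
    (d : reducedCrossedProduct α) (b : ell2 →L[ℂ] ell2) :
    unabsorb W q H (opTensor (d : ℓ²(G,H) →L[ℂ] ℓ²(G,H)) (shift hW g b)) =
      opTensor (fiberIncl α (g : G) (coeff α g d) : ℓ²(G,H) →L[ℂ] ℓ²(G,H)) b := by
  let ι : reducedCrossedProduct α →L[ℂ] (ℓ²(G,H) →L[ℂ] ℓ²(G,H)) :=
    (reducedCrossedProduct α).toSubalgebra.toSubmodule.subtypeL
  have hd : unabsorb W q H ∘L opTensorRight ℓ²(G,H) (shift hW g b) ∘L ι =
      opTensorRight ℓ²(G,H) b ∘L ι ∘L fiberIncl α (g : G) ∘L coeff α (g : G) :=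
    ext_fiberIncl α fun h a => unabsorb_opTensor_fiberIncl α hW hq g h a b
  exact DFunLike.congr_fun hd d

lemma exists_absorption (Γ : Subgroup G) [Countable Γ] :
    ∃ Θ Ψ : (HilbertTensor ℓ²(G,H) →L[ℂ] HilbertTensor ℓ²(G,H)) →L[ℂ]
        (HilbertTensor ℓ²(G,H) →L[ℂ] HilbertTensor ℓ²(G,H)),
      ‖Ψ‖ ≤ 1 ∧ ∀ (g : Γ) (b : ell2 →L[ℂ] ell2), ∃ b' : ell2 →L[ℂ] ell2,
        (∀ a, Θ (opTensor (fiberIncl α (g : G) a : ℓ²(G,H) →L[ℂ] ℓ²(G,H)) b) =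
          opTensor (fiberIncl α (g : G) a : ℓ²(G,H) →L[ℂ] ℓ²(G,H)) b') ∧
        ∀ d : reducedCrossedProduct α, Ψ (opTensor (d : ℓ²(G,H) →L[ℂ] ℓ²(G,H)) b') =
          opTensor (fiberIncl α (g : G) (coeff α g d) : ℓ²(G,H) →L[ℂ] ℓ²(G,H)) b := by
  obtain ⟨W, hW⟩ := exists_orthogonalFamily_ell2 Γ
  obtain ⟨q, hq⟩ := exists_equivariant_retraction Γ
  exact ⟨absorb hW q H, unabsorb W q H, IsColumnContraction.norm_sandwich_le _ _, fun g b =>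
    ⟨shift hW g b, fun a => absorb_opTensor_fiberIncl α hW hq g a b,
      fun d => unabsorb_opTensor α hW hq g d b⟩⟩

/-- The coefficient map `a ↦ E_g(Φ(π(a) λ_g))` of a map `Φ` on `A ⋊ G`, with `E_g` the Fourier
coefficient at `g`. -/
def diagonalPart (Φ : reducedCrossedProduct α →L[ℂ] reducedCrossedProduct α) (g : G) : A →L[ℂ] A :=
  coeff α g ∘L Φ ∘L fiberIncl α g

lemma fiberIncl_diagonalPart_id (g : G) (a : A) :
    fiberIncl α g (diagonalPart α (CBMap.id (reducedCrossedProduct α) : _ →L[ℂ] _) g a) =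
      fiberIncl α g a :=
  congrArg (fiberIncl α g) ((coeff_fiberIncl α g g a).trans (if_pos rfl))

lemma exists_forall_dist_amplify_le (x : minTensor (reducedCrossedProduct α)) :
    ∃ z, ∀ Φ ∈ CBMap (reducedCrossedProduct α), ∀ S ∈ CBMap (reducedCrossedProduct α),
      (∀ g a, S (fiberIncl α g a) = fiberIncl α g (diagonalPart α Φ g a)) →
        dist (amplify S x) x ≤ dist (amplify Φ z) z := by
  have hcountable := exists_countable_subgroup_mem_closure α x
  obtain ⟨Γ, hΓ, hx⟩ := hcountable
  have habsorption := exists_absorption α Γ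
  obtain ⟨Θ, Ψ, hΨ, hΘΨ⟩ := habsorption
  refine exists_forall_dist_amplify_le_of_rel (Θ := Θ) hΨ
    (fun g a => (fiberIncl_diagonalPart_id α g a).symm) ?_ hx
  rintro _ ⟨g, a, b, rfl⟩
  have hgb := hΘΨ g b
  obtain ⟨b', hΘ, hΨ⟩ := hgb
  exact ⟨fiberIncl α (g : G) a, b, b', rfl, hΘ a,
    fun Φ S hΦS => (hΨ _).trans (by rw [hΦS]; rfl)⟩

end Absorption

section FiniteRank

variable {𝕜 E F E' F' : Type*} [NontriviallyNormedField 𝕜] [NormedAddCommGroup E] [NormedSpace 𝕜 E]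
  [NormedAddCommGroup F] [NormedSpace 𝕜 F] [NormedAddCommGroup E'] [NormedSpace 𝕜 E']
  [NormedAddCommGroup F'] [NormedSpace 𝕜 F']

variable (𝕜 E F) in
/-- The subspace of bounded linear maps of finite rank; `LinearMap.finiteRange` is its counterpart
without continuity. -/
def finiteRank : Submodule 𝕜 (E →L[𝕜] F) :=
  (LinearMap.finiteRange 𝕜 E F).comap (ContinuousLinearMap.coeLM 𝕜)

lemma mem_finiteRank_iff {T : E →L[𝕜] F} :
    T ∈ finiteRank 𝕜 E F ↔ FiniteDimensional 𝕜 (LinearMap.range T.toLinearMap) :=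
  LinearMap.mem_finiteRange_iff_hasFiniteRange.trans Module.Finite.iff_fg.symm

lemma comp_mem_finiteRank (S : F →L[𝕜] F') {T : E →L[𝕜] F} (hT : T ∈ finiteRank 𝕜 E F)
    (R : E' →L[𝕜] E) : S ∘L T ∘L R ∈ finiteRank 𝕜 E' F' :=
  (LinearMap.HasNoetherianRange.comp_right (v := T.toLinearMap) (u := R.toLinearMap) hT).comp_left
    S.toLinearMap

lemma smulRight_mem_finiteRank (φ : E →L[𝕜] 𝕜) (c : F) : φ.smulRight c ∈ finiteRank 𝕜 E F :=
  LinearMap.HasNoetherianRange.comp_left (u := φ.toLinearMap) .of_isNoetherian_rng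
    (LinearMap.toSpanSingleton 𝕜 F c)

end FiniteRank

section WeakApproximation

variable {𝕜 V E X ι : Type*} [RCLike 𝕜] [AddCommGroup V] [Module 𝕜 V] [NormedAddCommGroup E]
  [NormedSpace 𝕜 E]

lemma mem_closure_of_tendsto_dual (M : Submodule 𝕜 E) {l : Filter ι} [l.NeBot] {m : ι → E} {p : E}
    (hm : ∀ i, m i ∈ M) (h : ∀ f : E →L[𝕜] 𝕜, Tendsto (fun i => f (m i)) l (𝓝 (f p))) :
    p ∈ closure (M : Set E) := by
  let _ : NormedSpace ℝ E := NormedSpace.restrictScalars ℝ 𝕜 E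
  have : IsScalarTower ℝ 𝕜 E := RestrictScalars.isScalarTower ℝ 𝕜 E
  by_contra hp
  obtain ⟨f, u, hu, hup⟩ := RCLike.geometric_hahn_banach_closed_point (𝕜 := 𝕜)
    (M.restrictScalars ℝ).convex.closure isClosed_closure hp
  exact hup.not_ge (le_of_tendsto ((RCLike.continuous_re.tendsto _).comp (h f))
    (.of_forall fun i => (hu _ (subset_closure (hm i))).le))

lemma exists_forall_dist_lt_of_tendsto_dual [Finite X] {l : Filter ι} [l.NeBot]
    (M : Submodule 𝕜 V) (L : X → V →ₗ[𝕜] E) {v : ι → V} (hv : ∀ i, v i ∈ M) {p : X → E}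
    (h : ∀ x (ψ : E →L[𝕜] 𝕜), Tendsto (fun i => ψ (L x (v i))) l (𝓝 (ψ (p x))))
    {ε : ℝ} (hε : 0 < ε) : ∃ w ∈ M, ∀ x, dist (L x w) (p x) < ε := by
  classical
  cases nonempty_fintype X
  have hdual (f : (X → E) →L[𝕜] 𝕜) :
      Tendsto (fun i => f (LinearMap.pi L (v i))) l (𝓝 (f p)) := by
    have hf (q : X → E) : f q = ∑ x, f (Pi.single x (q x)) := by
      rw [← map_sum, Finset.univ_sum_single]
    simp only [hf (LinearMap.pi L _), hf p]
    exact tendsto_finsetSum _ fun x _ => h x (f ∘L .single 𝕜 (fun _ : X => E) x)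
  have hp : p ∈ closure (M.map (LinearMap.pi L) : Set (X → E)) :=
    mem_closure_of_tendsto_dual _ (fun i => Submodule.mem_map_of_mem (hv i)) hdual
  obtain ⟨_, ⟨w, hw, rfl⟩, hd⟩ := Metric.mem_closure_iff.1 hp ε hε
  exact ⟨w, hw, (dist_pi_lt_iff hε).1 (dist_comm p _ ▸ hd)⟩

lemma exists_tendsto_of_forall_finset {β Y : Type*} [PseudoMetricSpace Y] (f : β → Y → Y)
    (P : β → Prop) (h : ∀ (X : Finset Y) (ε : ℝ), 0 < ε → ∃ b, P b ∧ ∀ x ∈ X, dist (f b x) x < ε) :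
    ∃ b : Finset Y × ℕ → β, (∀ i, P (b i)) ∧ ∀ x, Tendsto (fun i => f (b i) x) atTop (𝓝 x) := by
  choose b hP hb using fun i : Finset Y × ℕ => h i.1 (1 / ((i.2 : ℝ) + 1)) Nat.one_div_pos_of_nat
  refine ⟨b, hP, fun x => Metric.tendsto_nhds.2 fun ε hε => ?_⟩
  obtain ⟨n, hn⟩ := exists_nat_one_div_lt hε
  filter_upwards [eventually_ge_atTop (({x}, n) : Finset Y × ℕ)] with i ⟨hx, hni⟩
  calc dist (f (b i) x) x < 1 / ((i.2 : ℝ) + 1) := hb i x (hx (Finset.mem_singleton_self x))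
    _ ≤ 1 / ((n : ℝ) + 1) := Nat.one_div_le_one_div hni
    _ < ε := hn

end WeakApproximation

section MatrixUnits

variable {K : Type*} [NormedAddCommGroup K] [InnerProductSpace ℂ K] [CompleteSpace K]
  {C : StarSubalgebra ℂ (K →L[ℂ] K)} {n : ℕ}

/-- The matrix unit `eᵢⱼ` in `B(ℓ²)`. -/
def matrixUnit (i j : ℕ) : ell2 →L[ℂ] ell2 := (innerSL ℂ (basisVec j)).smulRight (basisVec i)

lemma matrixUnit_apply (i j : ℕ) (v : ell2) : matrixUnit i j v = v j • basisVec i := by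
  simp [matrixUnit, inner_basisVec]

lemma basisVec_apply (i j : ℕ) : basisVec i j = if j = i then 1 else 0 := by
  simp [basisVec, lp.single_apply, Pi.single_apply]

lemma matrixUnit_basisVec_apply (i j k l : ℕ) :
    matrixUnit i j (basisVec l) k = if k = i ∧ l = j then 1 else 0 := by
  rw [matrixUnit_apply, lp.coeFn_smul, Pi.smul_apply, basisVec_apply, basisVec_apply]
  simp [ite_and, eq_comm (a := l)]

variable (K n) in
/-- `colIncl`, which identifies `Kⁿ` with `K ⊗ ℂⁿ ⊆ K ⊗ ℓ²`, as an isometry. -/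
def colInclₗᵢ : PiLp 2 (fun _ : Fin n => K) →ₗᵢ[ℂ] HilbertTensor K where
  toFun := colIncl n
  map_add' := colIncl_add n
  map_smul' := colIncl_smul n
  norm_map' := norm_colIncl n

lemma adjoint_colInclₗᵢ_incl_tmul (k : K) (v : ell2) :
    (colInclₗᵢ K n).toContinuousLinearMap.adjoint (HilbertTensor.incl K (k ⊗ₜ v)) =
      WithLp.toLp 2 fun j : Fin n => v j • k := by
  refine ext_inner_left ℂ fun ξ => ?_
  have hξ : (colInclₗᵢ K n).toContinuousLinearMap ξ =
      HilbertTensor.incl K (∑ j : Fin n, ξ j ⊗ₜ basisVec j) := rfl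
  rw [ContinuousLinearMap.adjoint_inner_right, hξ, LinearIsometry.inner_map_map, sum_inner,
    PiLp.inner_apply]
  refine Finset.sum_congr rfl fun j _ => ?_
  rw [TensorProduct.inner_tmul, inner_basisVec, inner_smul_right, mul_comm]

/-- The element `∑ xᵢⱼ ⊗ eᵢⱼ` of `C ⊙ B(ℓ²)` given by a matrix over `C`. -/
def ofMatrix (x : Matrix (Fin n) (Fin n) C) : C ⊗[ℂ] (ell2 →L[ℂ] ell2) :=
  ∑ i, ∑ j, x i j ⊗ₜ matrixUnit i j

lemma corner_ofMatrix (x : Matrix (Fin n) (Fin n) C) : corner n (ofMatrix x) = x := by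
  ext i j : 2
  simp [corner, ofMatrix, slice_tmul, matrixUnit_basisVec_apply, ite_and, Fin.val_inj]

lemma algTensorMap_ofMatrix (x : Matrix (Fin n) (Fin n) C) :
    algTensorMap C (ofMatrix x) = (colInclₗᵢ K n).toContinuousLinearMap ∘L
      blockOperator (x.map fun c => (c : K →L[ℂ] K)) ∘L
        (colInclₗᵢ K n).toContinuousLinearMap.adjoint := by
  refine HilbertTensor.ext_tmul fun k v => ?_
  have hcol (ξ : PiLp 2 (fun _ : Fin n => K)) : (colInclₗᵢ K n).toContinuousLinearMap ξ =
      HilbertTensor.incl K (∑ j : Fin n, ξ j ⊗ₜ basisVec j) := rfl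
  simp only [ContinuousLinearMap.comp_apply, adjoint_colInclₗᵢ_incl_tmul, hcol, blockOperator_apply,
    ofMatrix, map_sum, algTensorMap_tmul, sum_apply, opTensor_incl_tmul, TensorProduct.sum_tmul,
    Matrix.map_apply, map_smul, matrixUnit_apply, TensorProduct.smul_tmul]

lemma norm_algTensorMap_ofMatrix_le (x : Matrix (Fin n) (Fin n) C) :
    ‖algTensorMap C (ofMatrix x)‖ ≤ ‖blockOperator (x.map fun c => (c : K →L[ℂ] K))‖ := by
  set B := blockOperator (x.map fun c => (c : K →L[ℂ] K))
  set J := (colInclₗᵢ K n).toContinuousLinearMap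
  have hJ : ‖J‖ ≤ 1 := (colInclₗᵢ K n).norm_toContinuousLinearMap_le
  have hJ' : ‖J.adjoint‖ ≤ 1 := (LinearIsometryEquiv.norm_map _ _).trans_le hJ
  rw [algTensorMap_ofMatrix]
  calc ‖J ∘L B ∘L J.adjoint‖ ≤ ‖J‖ * (‖B‖ * ‖J.adjoint‖) :=
        (J.opNorm_comp_le _).trans (by gcongr; exact B.opNorm_comp_le _)
    _ ≤ 1 * (‖B‖ * 1) := by gcongr
    _ = ‖B‖ := by rw [one_mul, mul_one]

lemma CBBound.smulRight (φ : C →L[ℂ] ℂ) (c : C) : CBBound (φ.smulRight c) (‖φ‖ * ‖c‖) := by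
  intro n x
  set u := TensorProduct.map (φ.smulRight c).toLinearMap LinearMap.id (ofMatrix x)
  have hu : corner n u = x.map (φ.smulRight c) := Matrix.ext fun i j =>
    (slice_map (φ.smulRight c) i j (ofMatrix x)).trans
      (congrArg (φ.smulRight c) (congrFun₂ (corner_ofMatrix x) i j))
  calc ‖blockOperator (x.map fun a => ((φ.smulRight c) a : K →L[ℂ] K))‖
      = ‖blockOperator ((corner n u).map fun a => (a : K →L[ℂ] K))‖ := by rw [hu]; rfl
    _ ≤ ‖algTensorMap C u‖ := norm_corner_le n u
    _ ≤ ‖φ‖ * ‖c‖ * ‖algTensorMap C (ofMatrix x)‖ := norm_algTensorMap_map_smulRight_le φ c _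
    _ ≤ _ := by gcongr; exact norm_algTensorMap_ofMatrix_le x

lemma eq_sum_smulRight_of_mem_finiteRank {T : C →L[ℂ] C} (hT : T ∈ finiteRank ℂ C C) :
    ∃ (n : ℕ) (φ : Fin n → C →L[ℂ] ℂ) (c : Fin n → C), T = ∑ k, (φ k).smulRight (c k) := by
  obtain ⟨n, φ, c, h⟩ := exists_eq_sum_smulRight T (mem_finiteRank_iff.1 hT)
  exact ⟨n, φ, c, ContinuousLinearMap.ext fun x => by simp [h, sum_apply]⟩

lemma smulRight_mem_cbMap (φ : C →L[ℂ] ℂ) (c : C) : φ.smulRight c ∈ CBMap C :=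
  ⟨_, CBBound.smulRight φ c⟩

lemma finiteRank_le_cbMap : finiteRank ℂ C C ≤ CBMap C := by
  intro T hT
  obtain ⟨n, φ, c, rfl⟩ := eq_sum_smulRight_of_mem_finiteRank hT
  exact sum_mem fun k _ => smulRight_mem_cbMap (φ k) (c k)

end MatrixUnits

section Amplification

variable {K : Type*} [NormedAddCommGroup K] [InnerProductSpace ℂ K] [CompleteSpace K]
  {C : StarSubalgebra ℂ (K →L[ℂ] K)}

/-- `T ↦ (T ⊗ id) x` as a linear map on `CB(C)`. -/
def amplifyEval (x : minTensor C) : CBMap C →ₗ[ℂ] minTensor C where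
  toFun T := amplify (T : C →L[ℂ] C) x
  map_add' S T := by rw [amplify_add, add_apply]
  map_smul' z T := by rw [amplify_smul, smul_apply, RingHom.id_apply]

lemma norm_amplify_smulRight_le (φ : C →L[ℂ] ℂ) (c : C) (x : minTensor C) :
    ‖amplify (φ.smulRight c) x‖ ≤ ‖φ‖ * ‖c‖ * ‖x‖ := by
  refine (denseRange_toMinTensor C).induction_on
    (p := fun x => ‖amplify (φ.smulRight c) x‖ ≤ ‖φ‖ * ‖c‖ * ‖x‖) x
    (isClosed_le (by fun_prop) (by fun_prop)) fun u => ?_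
  rw [amplify_toMinTensor ⟨_, smulRight_mem_cbMap φ c⟩]
  exact norm_algTensorMap_map_smulRight_le φ c u

/-- `c ↦ φ(·)c` as a linear map into `CB(C)`. -/
def smulRightCB (φ : C →L[ℂ] ℂ) : C →ₗ[ℂ] CBMap C :=
  (ContinuousLinearMap.smulRightL ℂ C C φ).toLinearMap.codRestrict (CBMap C) (smulRight_mem_cbMap φ)

lemma continuous_amplify_sum_smulRight {n : ℕ} (φ : Fin n → C →L[ℂ] ℂ) (x : minTensor C) :
    Continuous fun c : Fin n → C => amplify (∑ k, (φ k).smulRight (c k)) x := by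
  have hrank (k) : Continuous (amplifyEval x ∘ₗ smulRightCB (φ k)) :=
    AddMonoidHomClass.continuous_of_bound _ (‖φ k‖ * ‖x‖) fun c =>
      (norm_amplify_smulRight_le (φ k) c x).trans_eq (by ring)
  have hsum (c : Fin n → C) : amplify (∑ k, (φ k).smulRight (c k)) x =
      ∑ k, amplifyEval x (smulRightCB (φ k) (c k)) := by
    have hcoe : ((∑ k, smulRightCB (φ k) (c k) : CBMap C) : C →L[ℂ] C) =
        ∑ k, (φ k).smulRight (c k) := AddSubmonoidClass.coe_finsetSum _ _
    rw [← map_sum, ← hcoe]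
    rfl
  simp only [hsum]
  exact continuous_finsetSum _ fun k _ => (hrank k).comp (continuous_apply k)

end Amplification

section Approximation

variable {K : Type u} [NormedAddCommGroup K] [InnerProductSpace ℂ K] [CompleteSpace K]
  {C : StarSubalgebra ℂ (K →L[ℂ] K)}

lemma HasSOAP.exists_finiteRank_range_le (h : HasSOAP C) {D : Submodule ℂ C}
    (hD : Dense (D : Set C)) (Z : Finset (minTensor C)) {ε : ℝ} (hε : 0 < ε) :
    ∃ Φ ∈ finiteRank ℂ C C, LinearMap.range Φ.toLinearMap ≤ D ∧
      ∀ z ∈ Z, dist (amplify Φ z) z < ε := by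
  obtain ⟨ι, _, _, _, Φ, hΦ, hconv⟩ := h
  obtain ⟨i, hi⟩ := ((Finset.eventually_all Z).2 fun z _ =>
    Metric.tendsto_nhds.1 (hconv z) ε hε).exists
  obtain ⟨n, φ, c, hc⟩ := eq_sum_smulRight_of_mem_finiteRank (mem_finiteRank_iff.2 (hΦ i))
  rw [hc] at hi
  have hopen : IsOpen {d : Fin n → C | ∀ z ∈ Z,
      dist (amplify (∑ k, (φ k).smulRight (d k)) z) z < ε} := by
    simp only [Set.ofPred_forall]
    exact isOpen_biInter_finset fun z _ => isOpen_lt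
      ((continuous_amplify_sum_smulRight φ z).dist continuous_const) continuous_const
  obtain ⟨d, hdD, hd⟩ := (dense_pi Set.univ fun (_ : Fin n) _ => hD).exists_mem_open hopen ⟨c, hi⟩
  refine ⟨∑ k, (φ k).smulRight (d k), sum_mem fun k _ => smulRight_mem_finiteRank _ _, ?_, hd⟩
  rintro _ ⟨x, rfl⟩
  simpa [sum_apply] using sum_mem fun k _ => D.smul_mem (φ k x) (hdD k trivial)

lemma omega_id (x : minTensor C) (ψ : minTensor C →L[ℂ] ℂ) : omega x ψ (CBMap.id C) = ψ x :=
  congrArg (fun T : minTensor C →L[ℂ] minTensor C => ψ (T x)) amplify_id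

lemma hasSOAP_of_tendsto_omega {ι : Type*} {l : Filter ι} [l.NeBot] {T : ι → CBMap C}
    (hT : ∀ i, (T i : C →L[ℂ] C) ∈ finiteRank ℂ C C)
    (h : ∀ x ψ, Tendsto (fun i => omega x ψ (T i)) l (𝓝 (omega x ψ (CBMap.id C)))) :
    HasSOAP C := by
  classical
  simp only [omega_id] at h
  obtain ⟨Φ, hΦ, hconv⟩ := exists_tendsto_of_forall_finset
    (fun (T : CBMap C) x => amplify (T : C →L[ℂ] C) x)
    (fun T => (T : C →L[ℂ] C) ∈ finiteRank ℂ C C) fun X ε hε => by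
      obtain ⟨S, hS, hdist⟩ := exists_forall_dist_lt_of_tendsto_dual (X := X)
        ((finiteRank ℂ C C).submoduleOf (CBMap C)) (fun x => amplifyEval x.1) hT
        (p := Subtype.val) (fun x ψ => h x ψ) hε
      exact ⟨S, hS, fun x hx => hdist ⟨x, hx⟩⟩
  exact ⟨_, inferInstance, inferInstance, inferInstance, fun i => (Φ i : C →L[ℂ] C),
    fun i => mem_finiteRank_iff.1 (hΦ i), hconv⟩

lemma tendsto_omega {ι : Type*} {l : Filter ι} {T : ι → CBMap C} {x : minTensor C}
    (h : Tendsto (fun i => amplify (T i : C →L[ℂ] C) x) l (𝓝 x)) (ψ : minTensor C →L[ℂ] ℂ) :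
    Tendsto (fun i => omega x ψ (T i)) l (𝓝 (omega x ψ (CBMap.id C))) := by
  rw [omega_id]
  exact (ψ.continuous.tendsto x).comp h

lemma exists_tendsto_omega_of_forall_finset {β : Type*} (S : β → CBMap C) (P : β → Prop)
    (h : ∀ (X : Finset (minTensor C)) (ε : ℝ), 0 < ε →
      ∃ b, P b ∧ ∀ x ∈ X, dist (amplify (S b : C →L[ℂ] C) x) x < ε) :
    ∃ b : Finset (minTensor C) × ℕ → β, (∀ i, P (b i)) ∧
      ∀ x ψ, Tendsto (fun i => omega x ψ (S (b i))) atTop (𝓝 (omega x ψ (CBMap.id C))) := by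
  obtain ⟨b, hb, hconv⟩ := exists_tendsto_of_forall_finset
    (fun b x => amplify (S b : C →L[ℂ] C) x) P h
  exact ⟨b, hb, fun x ψ => tendsto_omega (hconv x) ψ⟩

lemma exists_forall_cbBound {ι : Type*} {F : ι → CBMap C} (hF : {i | F i ≠ 0}.Finite) :
    ∃ M : ℝ, ∀ i, CBBound (F i : C →L[ℂ] C) M := by
  choose M hM using fun T : CBMap C => T.2
  obtain ⟨N, hN⟩ := ((hF.image (M ∘ F)).insert (M 0)).bddAbove
  refine ⟨N, fun i => (hM (F i)).mono (hN ?_)⟩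
  by_cases hi : F i = 0
  · exact Or.inl (congrArg M hi)
  · exact Or.inr ⟨i, hi, rfl⟩

end Approximation

section Multipliers

variable {H : Type*} [NormedAddCommGroup H] [InnerProductSpace ℂ H] [CompleteSpace H] {G : Type*}
  [Group G] {A : StarSubalgebra ℂ (H →L[ℂ] H)} [IsClosed (A : Set (H →L[ℂ] H))]
  (α : G →* (A ≃⋆ₐ[ℂ] A))

variable [DecidableEq G]

/-- The map `π ⋊ λ (f) ↦ ∑_{r ∈ s} π(F(r)(f(r))) λ_r`, which is `S_F` when `F` vanishes
off `s`. -/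
def multiplierMap (F : G → CBMap A) (s : Finset G) :
    reducedCrossedProduct α →L[ℂ] reducedCrossedProduct α :=
  ∑ r ∈ s, fiberIncl α r ∘L (F r : A →L[ℂ] A) ∘L coeff α r

variable {F : G → CBMap A} {s : Finset G}

lemma multiplierMap_mem_finiteRank (hF : ∀ r, (F r : A →L[ℂ] A) ∈ finiteRank ℂ A A)
    (s : Finset G) : multiplierMap α F s ∈
      finiteRank ℂ (reducedCrossedProduct α) (reducedCrossedProduct α) :=
  sum_mem fun r _ => comp_mem_finiteRank _ (hF r) _

lemma multiplierMap_fiberIncl (hs : ∀ r ∉ s, F r = 0) (g : G) (a : A) :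
    multiplierMap α F s (fiberIncl α g a) = fiberIncl α g ((F g : A →L[ℂ] A) a) := by
  have h (r : G) : fiberIncl α r ((F r : A →L[ℂ] A) (coeff α r (fiberIncl α g a))) =
      if g = r then fiberIncl α g ((F g : A →L[ℂ] A) a) else 0 := by
    rw [coeff_fiberIncl]
    split_ifs with hgr
    · rw [hgr]
    · rw [map_zero, map_zero]
  simp only [multiplierMap, sum_apply, ContinuousLinearMap.comp_apply, h, Finset.sum_ite_eq]
  split_ifs with hg
  · rfl
  · rw [hs g hg, ZeroMemClass.coe_zero, zero_apply, map_zero]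

lemma coe_multiplierMap_apply (F : G → CBMap A) (s : Finset G) (x : reducedCrossedProduct α) :
    (multiplierMap α F s x : ℓ²(G,H) →L[ℂ] ℓ²(G,H)) =
      ∑ r ∈ s, piRep α ((F r : A →L[ℂ] A) (coeff α r x)) * lam H r := by
  have h : multiplierMap α F s x =
      ∑ r ∈ s, fiberIncl α r ((F r : A →L[ℂ] A) (coeff α r x)) := by
    simp only [multiplierMap, sum_apply, ContinuousLinearMap.comp_apply]
  rw [h, AddSubmonoidClass.coe_finsetSum]
  exact Finset.sum_congr rfl fun r _ => coe_fiberIncl α r _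

lemma isMultiplierMap_multiplierMap (hs : ∀ r ∉ s, F r = 0)
    (hcb : multiplierMap α F s ∈ CBMap (reducedCrossedProduct α)) :
    IsMultiplierMap α F ⟨multiplierMap α F s, hcb⟩ := by
  intro f hf
  have hzero (r : G) (hr : r ∉ s) : piRep α ((F r : A →L[ℂ] A) (f r)) * lam H r = 0 := by
    rw [hs r hr, ZeroMemClass.coe_zero, zero_apply, ← coe_fiberIncl, map_zero,
      ZeroMemClass.coe_zero]
  refine (coe_multiplierMap_apply α F s _).trans (Eq.trans ?_ (tsum_eq_sum hzero).symm)
  exact Finset.sum_congr rfl fun r _ =>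
    congrArg (fun a => piRep α ((F r : A →L[ℂ] A) a) * lam H r) (coeff_integratedForm α hf r)

omit [DecidableEq G] in
lemma isHerzSchurMultiplier_of_finite_support (hs : {r | F r ≠ 0}.Finite)
    (hF : ∀ r, (F r : A →L[ℂ] A) ∈ finiteRank ℂ A A) : IsHerzSchurMultiplier α F := by
  classical
  have hcb := finiteRank_le_cbMap (multiplierMap_mem_finiteRank α hF hs.toFinset)
  exact ⟨exists_forall_cbBound hs, _, isMultiplierMap_multiplierMap α (by simp) hcb⟩

variable {α} in
lemma coe_toCBMap_eq_multiplierMap (F : HerzSchurMultiplier α)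
    (hs : {r | F.1 r ≠ 0}.Finite) (hF : ∀ r, (F.1 r : A →L[ℂ] A) ∈ finiteRank ℂ A A) :
    (F.toCBMap : reducedCrossedProduct α →L[ℂ] reducedCrossedProduct α) =
      multiplierMap α F.1 hs.toFinset := by
  have hcb : multiplierMap α F.1 hs.toFinset ∈ CBMap (reducedCrossedProduct α) :=
    finiteRank_le_cbMap (multiplierMap_mem_finiteRank α hF _)
  have hs' (r : G) (hr : r ∉ hs.toFinset) : F.1 r = 0 := by simpa using hr
  have hmul := isMultiplierMap_multiplierMap α hs' hcb
  have heq : F.toCBMap = ⟨multiplierMap α F.1 hs.toFinset, hcb⟩ :=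
    IsMultiplierMap.unique α (F.isMultiplierMap_toCBMap α) hmul
  exact congrArg Subtype.val heq

omit [DecidableEq G] in
variable {α} in
lemma toCBMap_mem_finiteRank (F : HerzSchurMultiplier α) (hs : {r | F.1 r ≠ 0}.Finite)
    (hF : ∀ r, (F.1 r : A →L[ℂ] A) ∈ finiteRank ℂ A A) :
    (F.toCBMap : reducedCrossedProduct α →L[ℂ] reducedCrossedProduct α) ∈
      finiteRank ℂ (reducedCrossedProduct α) (reducedCrossedProduct α) := by
  classical
  have hS := coe_toCBMap_eq_multiplierMap F hs hF
  exact Set.mem_of_eq_of_mem hS (multiplierMap_mem_finiteRank α hF _)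

variable {Φ : reducedCrossedProduct α →L[ℂ] reducedCrossedProduct α}

lemma diagonalPart_mem_finiteRank
    (hΦ : Φ ∈ finiteRank ℂ (reducedCrossedProduct α) (reducedCrossedProduct α)) (g : G) :
    diagonalPart α Φ g ∈ finiteRank ℂ A A :=
  comp_mem_finiteRank _ hΦ _

lemma finite_support_diagonalPart
    (hΦ : Φ ∈ finiteRank ℂ (reducedCrossedProduct α) (reducedCrossedProduct α))
    (hrange : LinearMap.range Φ.toLinearMap ≤ fiberSpan α) :
    {g | diagonalPart α Φ g ≠ 0}.Finite := by
  obtain ⟨t, ht⟩ : (LinearMap.range Φ.toLinearMap).FG :=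
    LinearMap.mem_finiteRange_iff_hasFiniteRange.1 hΦ
  have htsub (x) (hx : x ∈ t) : x ∈ fiberSpan α := hrange (ht ▸ Submodule.subset_span hx)
  refine (t.finite_toSet.biUnion fun x hx => finite_support_coeff α (htsub x hx)).subset
    fun g hg => ?_
  by_contra hnot
  simp only [Set.mem_iUnion, not_exists, Set.mem_ofPred_eq, not_not] at hnot
  have hker : LinearMap.range Φ.toLinearMap ≤ LinearMap.ker (coeff α g).toLinearMap :=
    ht ▸ Submodule.span_le.2 hnot
  exact hg (ContinuousLinearMap.ext fun a => hker ⟨fiberIncl α g a, rfl⟩)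

lemma exists_herzSchurMultiplier_diagonalPart
    (hΦ : Φ ∈ finiteRank ℂ (reducedCrossedProduct α) (reducedCrossedProduct α))
    (hrange : LinearMap.range Φ.toLinearMap ≤ fiberSpan α) :
    ∃ F : HerzSchurMultiplier α,
      ({r | F.1 r ≠ 0}.Finite ∧ ∀ r, (F.1 r : A →L[ℂ] A) ∈ finiteRank ℂ A A) ∧
      ∀ g a, (F.toCBMap : reducedCrossedProduct α →L[ℂ] reducedCrossedProduct α)
        (fiberIncl α g a) = fiberIncl α g (diagonalPart α Φ g a) := by
  have hrank (g : G) : diagonalPart α Φ g ∈ finiteRank ℂ A A := diagonalPart_mem_finiteRank α hΦ g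
  let D (g : G) : CBMap A := ⟨diagonalPart α Φ g, finiteRank_le_cbMap (hrank g)⟩
  have hD : {g | D g ≠ 0}.Finite :=
    (finite_support_diagonalPart α hΦ hrange).subset fun g hg h => hg (Subtype.ext h)
  let F : HerzSchurMultiplier α := ⟨D, isHerzSchurMultiplier_of_finite_support α hD hrank⟩
  refine ⟨F, ⟨hD, hrank⟩, fun g a => ?_⟩
  have hS := coe_toCBMap_eq_multiplierMap F hD hrank
  rw [hS]
  exact multiplierMap_fiberIncl α (by simp [F]) g a

end Multipliers

section Main

variable {H : Type u} [NormedAddCommGroup H] [InnerProductSpace ℂ H] [CompleteSpace H]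
  {G : Type v} [Group G] {A : StarSubalgebra ℂ (H →L[ℂ] H)} [IsClosed (A : Set (H →L[ℂ] H))]
  {α : G →* (A ≃⋆ₐ[ℂ] A)}

lemma hasSOAP_of_hasAP (h : HasAP α) : HasSOAP (reducedCrossedProduct α) := by
  obtain ⟨ι, _, _, _, F, hs, hF, hconv⟩ := h
  have hrank (i : ι) (r : G) : ((F i).1 r : A →L[ℂ] A) ∈ finiteRank ℂ A A :=
    mem_finiteRank_iff.2 (hF i r)
  exact hasSOAP_of_tendsto_omega (T := fun i => (F i).toCBMap) (l := atTop)
    (fun i => toCBMap_mem_finiteRank (F i) (hs i) (hrank i)) fun x ψ => hconv _ ⟨x, ψ, rfl⟩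

lemma exists_herzSchurMultiplier_dist_lt (h : HasSOAP (reducedCrossedProduct α))
    (X : Finset (minTensor (reducedCrossedProduct α))) {ε : ℝ} (hε : 0 < ε) :
    ∃ F : HerzSchurMultiplier α,
      ({r | F.1 r ≠ 0}.Finite ∧ ∀ r, (F.1 r : A →L[ℂ] A) ∈ finiteRank ℂ A A) ∧
      ∀ x ∈ X, dist (amplify (F.toCBMap : reducedCrossedProduct α →L[ℂ] _) x) x < ε := by
  classical
  choose z hz using exists_forall_dist_amplify_le α
  have happrox := h.exists_finiteRank_range_le (dense_fiberSpan α) (X.image z) hε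
  obtain ⟨Φ, hΦ, hrange, hdist⟩ := happrox
  have hmul := exists_herzSchurMultiplier_diagonalPart α hΦ hrange
  obtain ⟨F, hF, hS⟩ := hmul
  exact ⟨F, hF, fun x hx => (hz x Φ (finiteRank_le_cbMap hΦ) _ F.toCBMap.2 hS).trans_lt
    (hdist (z x) (Finset.mem_image_of_mem z hx))⟩

lemma hasAP_of_hasSOAP (h : HasSOAP (reducedCrossedProduct α)) : HasAP α := by
  classical
  obtain ⟨F, hF, hconv⟩ := exists_tendsto_omega_of_forall_finset
    (C := reducedCrossedProduct α) (fun F : HerzSchurMultiplier α => F.toCBMap) _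
    fun X ε hε => exists_herzSchurMultiplier_dist_lt h X hε
  refine ⟨_, inferInstance, inferInstance, inferInstance, F, fun i => (hF i).1,
    fun i r => mem_finiteRank_iff.1 ((hF i).2 r), ?_⟩
  rintro _ ⟨x, ψ, rfl⟩
  exact hconv x ψ

end Main

end CrossedProductAP

end

theorem theorem4p4 {H : Type*} [NormedAddCommGroup H] [InnerProductSpace ℂ H] [CompleteSpace H]
    {G : Type*} [Group G] (A : StarSubalgebra ℂ (H →L[ℂ] H)) [IsClosed (A : Set (H →L[ℂ] H))]
    (α : G →* (A ≃⋆ₐ[ℂ] A)) :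
    CrossedProductAP.HasAP α ↔
      CrossedProductAP.HasSOAP (CrossedProductAP.reducedCrossedProduct α) :=
  ⟨CrossedProductAP.hasSOAP_of_hasAP, CrossedProductAP.hasAP_of_hasSOAP⟩
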